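/- Let $q$ be a complex number with $|q|<1$. Write $(a;q)_n=\prod_{k=1}^{n}(1-aq^{k-1})$ for $n\in\{0,1,2,\dots\}\cup\{\infty\}$ and $(a)_n=(a;q)_n$, and let $$f(q)=\sum_{n=0}^{\infty}\frac{q^{n^2}}{(-q)_n^2},\qquad \omega(q)=\sum_{n=0}^{\infty}\frac{q^{2n(n+1)}}{(q;q^2)_{n+1}^2}$$ be the third order mock theta functions. Then $$\frac{(q)_\infty^3}{(-q)_\infty^2}\,f(q)=-4\sum_{n=1}^{\infty}\frac{q^n}{(1-q^n)^2}-16\sum_{n=1}^{\infty}\frac{q^{2n}}{(1-q^{2n})^2}+1+4\sum_{\substack{n=-\infty\\ n\ne0}}^{\infty}\frac{q^{n(3n+1)/2}}{(1-q^n)^2}+2\sum_{\substack{n=-\infty\\ n\ne0}}^{\infty}\frac{(6n-1)q^{n(3n+1)/2}}{1-q^n}$$ and $$q\,\frac{(q^2;q^2)_\infty^3}{(-q;q^2)_\infty^2}\,\omega(-q)=\sum_{n=1}^{\infty}\frac{q^{2n-1}}{(1+q^{2n-1})^2}-2\sum_{n=1}^{\infty}\frac{q^{2n}}{(1-q^{2n})^2}+\sum_{\substack{n=-\infty\\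 n\ne0}}^{\infty}\frac{q^{3n^2}}{(1-q^{2n})^2}+\sum_{\substack{n=-\infty\\ n\ne0}}^{\infty}\frac{(3n-1)q^{3n^2}}{1-q^{2n}},$$ where all the series converge absolutely. (At $q=0$ the summands with $n<0$ are understood as their limits as $q\to0$, which are $0$.) -/

import Mathlib

namespace MockTheta

/-- The finite `q`-Pochhammer symbol `(a; q)_n = ∏_{k=1}^{n} (1 - a q^{k-1})`. -/
noncomputable def qPoch (a q : ℂ) (n : ℕ) : ℂ :=
  ∏ k ∈ Finset.range n, (1 - a * q ^ k)

/-- The infinite `q`-Pochhammer symbol `(a; q)_∞ = ∏_{k=1}^{∞} (1 - a q^{k-1})`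
(an absolutely convergent product for `‖q‖ < 1`, see `multipliable_qPochInf`). -/
noncomputable def qPochInf (a q : ℂ) : ℂ :=
  ∏' k : ℕ, (1 - a * q ^ k)

theorem multipliable_qPochInf (a : ℂ) {q : ℂ} (hq : ‖q‖ < 1) :
    Multipliable (fun k : ℕ => 1 - a * q ^ k) := by
  have h : Summable (fun k : ℕ => ‖-(a * q ^ k)‖) := by
    simpa [norm_mul, norm_pow] using
      (summable_geometric_of_lt_one (norm_nonneg q) hq).mul_left ‖a‖
  simpa [sub_eq_add_neg] using multipliable_one_add_of_summable h

/-- If no factor vanishes, then neither does the infinite product; in particular the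
denominators `(-q; q)_∞` and `(-q; q²)_∞` are nonzero for `‖q‖ < 1`. -/
theorem qPochInf_ne_zero {a q : ℂ} (hq : ‖q‖ < 1) (h0 : ∀ k : ℕ, a * q ^ k ≠ 1) :
    qPochInf a q ≠ 0 := by
  have h : Summable (fun k : ℕ => ‖-(a * q ^ k)‖) := by
    simpa [norm_mul, norm_pow] using
      (summable_geometric_of_lt_one (norm_nonneg q) hq).mul_left ‖a‖
  have := tprod_one_add_ne_zero_of_summable (f := fun k : ℕ => -(a * q ^ k))
    (fun k hk => h0 k (by linear_combination -hk)) h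
  simpa [qPochInf, sub_eq_add_neg] using this

/-- The `n`-th term `q^{n²} / (-q; q)_n²` of the series of `f(q)`. -/
noncomputable def fTerm (q : ℂ) (n : ℕ) : ℂ :=
  q ^ (n ^ 2) / qPoch (-q) q n ^ 2

/-- The third order mock theta function `f(q) = ∑_{n ≥ 0} q^{n²} / (-q; q)_n²`. -/
noncomputable def mockF (q : ℂ) : ℂ := ∑' n : ℕ, fTerm q n

/-- The `n`-th term `q^{2n(n+1)} / (q; q²)_{n+1}²` of the series of `ω(q)`. -/
noncomputable def omegaTerm (q : ℂ) (n : ℕ) : ℂ :=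
  q ^ (2 * n * (n + 1)) / qPoch q (q ^ 2) (n + 1) ^ 2

/-- The third order mock theta function
`ω(q) = ∑_{n ≥ 0} q^{2n(n+1)} / (q; q²)_{n+1}²`. -/
noncomputable def mockOmega (q : ℂ) : ℂ := ∑' n : ℕ, omegaTerm q n

end MockTheta

/-! Both identities say that the residues of a rational function of `y = x + 1/x` sum to zero,
followed by a passage to the limit.

In the variable `y` the product `(1 - p x)(1 - p/x)` is a linear polynomial, `nodeFactor p y`, with
root `p + 1/p`. For `f`, consider the reciprocal of `∏ nodeFactor (q^k) y ^ 2 * ∏ nodeFactor (-q^k)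
y` over `k ≤ N`; for `ω(-q)`, replace `q^k` by `q^(2k)` and `-q^k` by `-q^(2k+1)`. The degree is at
least two, so the residues sum to zero (`sum_residues_eq_zero`). They are of three kinds. The double
pole `y = 2` gives Lambert sums. The other double poles give a logarithmic derivative, hence factors
linear in `n`. The simple poles give a bilateral-type series in disguise. All products telescope to
finite Pochhammer symbols, which yields `f_finite_identity` and `omega_finite_identity`; dominated
convergence as `N → ∞` yields `f_lambert_identity` and `omega_lambert_identity`.

The simple-pole series is Watson's expansion of the mock theta function (`qPochInf_mul_mockF`,
`qPochInf_mul_mockOmega`). It comes from the same nodes: partial fractions of `1 / ∏ nodeFactor`,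
evaluated at `y = -2`, i.e. `x = -1`, expand `1 / (-q)_n^2` as a Bailey pair (`inv_qPoch_neg_sq`,
`inv_qPoch_neg_odd_sq`), and the limiting Bailey lemma `tsum_bailey` sums it. That lemma rests on
Cauchy's Durfee rectangle sum `tsum_durfeeTerm`.

Finally the terms `n` and `-n` of the integer-indexed sums are paired and compared with the
double-pole series. The nodes need `q ≠ 0`, so `q = 0` is checked directly. -/

namespace MockTheta

open Filter Topology Polynomial

/-! ### Pochhammer symbols: limits, nonvanishing, bounds -/

section Pochhammer

variable {a q : ℂ}

theorem qPoch_zero (a q : ℂ) : qPoch a q 0 = 1 := by simp [qPoch]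

theorem qPoch_succ (a q : ℂ) (n : ℕ) : qPoch a q (n + 1) = qPoch a q n * (1 - a * q ^ n) := by
  simp [qPoch, Finset.prod_range_succ]

theorem qPoch_add (a q : ℂ) (m n : ℕ) :
    qPoch a q (m + n) = qPoch a q m * qPoch (a * q ^ m) q n := by
  simp [qPoch, Finset.prod_range_add, pow_add, mul_assoc]

theorem tendsto_qPoch (a : ℂ) (hq : ‖q‖ < 1) :
    Tendsto (qPoch a q) atTop (𝓝 (qPochInf a q)) :=
  (multipliable_qPochInf a hq).hasProd.tendsto_prod_nat

theorem qPoch_ne_zero (h0 : ∀ k : ℕ, a * q ^ k ≠ 1) (n : ℕ) : qPoch a q n ≠ 0 :=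
  Finset.prod_ne_zero_iff.2 fun k _ => sub_ne_zero.2 (h0 k).symm

/-- The reciprocals converge because the limit product is nonzero. The resulting uniform bound feeds
every domination argument below. -/
theorem exists_norm_inv_qPoch_le (hq : ‖q‖ < 1) (h0 : ∀ k : ℕ, a * q ^ k ≠ 1) :
    ∃ C : ℝ, 0 ≤ C ∧ ∀ n, ‖(qPoch a q n)⁻¹‖ ≤ C := by
  have h := (tendsto_qPoch a hq).inv₀ (qPochInf_ne_zero hq h0)
  obtain ⟨C, hC⟩ := (Metric.isBounded_range_of_tendsto _ h).exists_norm_le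
  exact ⟨C, (norm_nonneg _).trans (hC _ ⟨0, rfl⟩), fun n => hC _ ⟨n, rfl⟩⟩

theorem pow_ne_one_of_norm_lt (hq : ‖q‖ < 1) {n : ℕ} (hn : n ≠ 0) : q ^ n ≠ 1 := by
  intro h
  have := congrArg norm h
  rw [norm_pow, norm_one] at this
  exact (pow_lt_one₀ (norm_nonneg q) hq hn).ne this

theorem neg_pow_ne_one_of_norm_lt (hq : ‖q‖ < 1) (n : ℕ) : -q ^ n ≠ 1 := by
  intro h
  rcases eq_or_ne n 0 with rfl | hn
  · norm_num at h
  · have := congrArg norm h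
    rw [norm_neg, norm_pow, norm_one] at this
    exact (pow_lt_one₀ (norm_nonneg q) hq hn).ne this

theorem one_sub_pow_ne_zero (hq : ‖q‖ < 1) {n : ℕ} (hn : n ≠ 0) : 1 - q ^ n ≠ 0 :=
  sub_ne_zero.2 (pow_ne_one_of_norm_lt hq hn).symm

theorem one_add_pow_ne_zero (hq : ‖q‖ < 1) (n : ℕ) : 1 + q ^ n ≠ 0 := by
  intro h
  exact neg_pow_ne_one_of_norm_lt hq n (by linear_combination -h)

theorem self_mul_pow_ne_one (hq : ‖q‖ < 1) (k : ℕ) : q * q ^ k ≠ 1 := by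
  rw [← pow_succ']
  exact pow_ne_one_of_norm_lt hq (by omega)

theorem neg_self_mul_pow_ne_one (hq : ‖q‖ < 1) (k : ℕ) : -q * q ^ k ≠ 1 := by
  rw [neg_mul, ← pow_succ']
  exact neg_pow_ne_one_of_norm_lt hq _

theorem neg_mul_sq_pow_ne_one (hq : ‖q‖ < 1) (k : ℕ) : -q * (q ^ 2) ^ k ≠ 1 := by
  rw [neg_mul, ← pow_mul, ← pow_succ']
  exact neg_pow_ne_one_of_norm_lt hq _

theorem norm_sq_lt_one (hq : ‖q‖ < 1) : ‖q ^ 2‖ < 1 := by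
  rw [norm_pow]
  exact pow_lt_one₀ (norm_nonneg q) hq two_ne_zero

end Pochhammer

/-! ### Vanishing of the sum of residues, by polynomial algebra -/

section Residues

open Finset

theorem sq_dvd_of_eval_derivative {P : ℂ[X]} {a : ℂ} (h0 : P.eval a = 0)
    (h1 : (derivative P).eval a = 0) : (X - C a) ^ 2 ∣ P := by
  obtain ⟨R, rfl⟩ := dvd_iff_isRoot.2 h0
  have hR : R.eval a = 0 := by simpa using h1
  obtain ⟨S, rfl⟩ := dvd_iff_isRoot.2 hR
  exact ⟨S, by ring⟩

/-- The sum of the residues of `1 / (∏ (y - a i) ^ 2 * ∏ (y - b j))` vanishes. -/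
theorem sum_residues_eq_zero {s t : Finset ℕ} {a b : ℕ → ℂ} (hs : s.Nonempty)
    (ha : ∀ i ∈ s, ∀ k ∈ s, i ≠ k → a i ≠ a k) (hb : ∀ i ∈ t, ∀ k ∈ t, i ≠ k → b i ≠ b k)
    (hab : ∀ i ∈ s, ∀ j ∈ t, a i ≠ b j) :
    ∑ i ∈ s, -((∏ k ∈ s.erase i, (a i - a k) ^ 2) * ∏ j ∈ t, (a i - b j))⁻¹ *
        (∑ k ∈ s.erase i, 2 / (a i - a k) + ∑ j ∈ t, 1 / (a i - b j)) +
      ∑ j ∈ t, ((∏ k ∈ s, (b j - a k) ^ 2) * ∏ i ∈ t.erase j, (b j - b i))⁻¹ = 0 := by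
  set Z : ℕ → ℂ[X] := fun i =>
    (∏ k ∈ s.erase i, (X - C (a k)) ^ 2) * ∏ j ∈ t, (X - C (b j)) with hZ
  set W : ℕ → ℂ[X] := fun j =>
    (∏ k ∈ s, (X - C (a k)) ^ 2) * ∏ i ∈ t.erase j, (X - C (b i)) with hW
  have hZe : ∀ i, (Z i).eval (a i) =
      (∏ k ∈ s.erase i, (a i - a k) ^ 2) * ∏ j ∈ t, (a i - b j) := by
    intro i; simp [hZ, eval_prod]
  have hWe : ∀ i, (W i).eval (b i) =
      (∏ k ∈ s, (b i - a k) ^ 2) * ∏ j ∈ t.erase i, (b i - b j) := by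
    intro i; simp [hW, eval_prod]
  have hZ0 : ∀ i ∈ s, (Z i).eval (a i) ≠ 0 := by
    intro i hi
    rw [hZe]
    refine mul_ne_zero (prod_ne_zero_iff.2 fun k hk => ?_) (prod_ne_zero_iff.2 fun j hj => ?_)
    · exact pow_ne_zero _ (sub_ne_zero.2
        (ha i hi k (mem_of_mem_erase hk) (ne_of_mem_erase hk).symm))
    · exact sub_ne_zero.2 (hab i hi j hj)
  have hW0 : ∀ j ∈ t, (W j).eval (b j) ≠ 0 := by
    intro j hj
    rw [hWe]
    refine mul_ne_zero (prod_ne_zero_iff.2 fun k hk => ?_) (prod_ne_zero_iff.2 fun i hi => ?_)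
    · exact pow_ne_zero _ (sub_ne_zero.2 (hab k hk j hj).symm)
    · exact sub_ne_zero.2 (hb j hj i (mem_of_mem_erase hi) (ne_of_mem_erase hi).symm)
  have hZd : ∀ i ∈ s, (derivative (Z i)).eval (a i) = (Z i).eval (a i) *
      (∑ k ∈ s.erase i, 2 / (a i - a k) + ∑ j ∈ t, 1 / (a i - b j)) := by
    intro i hi
    have h1 : ∀ k ∈ s.erase i, a i - a k ≠ 0 := fun k hk => sub_ne_zero.2
        (ha i hi k (mem_of_mem_erase hk) (ne_of_mem_erase hk).symm)
    have h2 : ∀ j ∈ t, a i - b j ≠ 0 := fun j hj => sub_ne_zero.2 (hab i hi j hj)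
    simp only [hZ, derivative_mul, derivative_prod_finset, eval_add, eval_mul, eval_finsetSum,
      eval_prod, eval_pow, eval_sub, eval_X, eval_C, derivative_X_sub_C_pow, derivative_X_sub_C,
      mul_add, sum_mul, mul_sum]
    congr 1
    · refine sum_congr rfl fun k hk => ?_
      rw [← mul_prod_erase _ _ hk]
      have := h1 k hk
      simp
      field_simp
    · refine sum_congr rfl fun k hk => ?_
      rw [← mul_prod_erase t (fun j => a i - b j) hk]
      have := h2 k hk
      simp
      field_simp
  -- `β i` is the residue `-Z'/Z²` at the double pole `a i`, written with the logarithmic derivative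
  -- of `Z i`. `T` is the numerator, over the common denominator `Q`, of the expected partial
  -- fraction expansion of `1 / Q`.
  set β : ℕ → ℂ := fun i => -((Z i).eval (a i))⁻¹ *
    (∑ k ∈ s.erase i, 2 / (a i - a k) + ∑ j ∈ t, 1 / (a i - b j)) with hβ
  set T : ℂ[X] := ∑ i ∈ s, (C ((Z i).eval (a i))⁻¹ * Z i + C (β i) * ((X - C (a i)) * Z i)) +
    ∑ j ∈ t, C ((W j).eval (b j))⁻¹ * W j with hT
  set Q : ℂ[X] := (∏ k ∈ s, (X - C (a k)) ^ 2) * ∏ j ∈ t, (X - C (b j)) with hQ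
  have hZm : ∀ i, (Z i).Monic := fun i =>
    (monic_prod_of_monic _ _ fun k _ => (monic_X_sub_C _).pow 2).mul
      (monic_prod_of_monic _ _ fun k _ => monic_X_sub_C _)
  have hWm : ∀ i, (W i).Monic := fun i =>
    (monic_prod_of_monic _ _ fun k _ => (monic_X_sub_C _).pow 2).mul
      (monic_prod_of_monic _ _ fun k _ => monic_X_sub_C _)
  have hQZ : ∀ i ∈ s, Q = (X - C (a i)) * ((X - C (a i)) * Z i) := by
    intro i hi
    rw [hQ, ← mul_prod_erase s _ hi]; ring
  have hQW : ∀ j ∈ t, Q = (X - C (b j)) * W j := by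
    intro i hi
    rw [hQ, ← mul_prod_erase t _ hi]; ring
  have dQZ : ∀ i ∈ s, Q.natDegree = (Z i).natDegree + 2 := by
    intro i hi
    rw [hQZ i hi, (monic_X_sub_C _).natDegree_mul ((monic_X_sub_C _).mul (hZm i)),
      (monic_X_sub_C _).natDegree_mul (hZm i)]
    simp; ring
  have dQW : ∀ j ∈ t, Q.natDegree = (W j).natDegree + 1 := by
    intro i hi
    rw [hQW i hi, (monic_X_sub_C _).natDegree_mul (hWm i)]
    simp; ring
  obtain ⟨i₀, hi₀⟩ := hs
  have hd2 : 2 ≤ Q.natDegree := by rw [dQZ i₀ hi₀]; omega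
  have dvdZ : ∀ i ∈ s, ∀ k ∈ s, k ≠ i → (X - C (a i)) ^ 2 ∣ Z k := fun i hi k hk hki =>
    (dvd_prod_of_mem (fun k => (X - C (a k)) ^ 2) (mem_erase.2 ⟨hki.symm, hi⟩)).mul_right _
  have dvdZb : ∀ i ∈ t, ∀ k, (X - C (b i)) ∣ Z k := fun i hi k =>
    (dvd_prod_of_mem (fun k => X - C (b k)) hi).mul_left _
  have dvdW : ∀ i ∈ s, ∀ k, (X - C (a i)) ^ 2 ∣ W k := fun i hi k =>
    (dvd_prod_of_mem (fun k => (X - C (a k)) ^ 2) hi).mul_right _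
  have dvdWb : ∀ i ∈ t, ∀ k ∈ t, k ≠ i → (X - C (b i)) ∣ W k := fun i hi k hk hki =>
    (dvd_prod_of_mem (fun k => X - C (b k)) (mem_erase.2 ⟨hki.symm, hi⟩)).mul_left _
  -- `T` agrees with `1` to second order at each `a i` and to first order at each `b j`. By
  -- coprimality `Q` divides `T - 1`, and the degree bound then forces `T = 1`.
  have hdvd : Q ∣ T - 1 := by
    refine IsCoprime.mul_dvd ?_ ?_ ?_
    · refine IsCoprime.prod_left fun i hi => IsCoprime.prod_right fun j hj => ?_
      exact (isCoprime_X_sub_C_of_isUnit_sub (sub_ne_zero.2 (hab i hi j hj)).isUnit).pow_left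
    · refine Finset.prod_dvd_of_coprime (fun i hi k hk hik => ?_) fun i hi => ?_
      · exact (isCoprime_X_sub_C_of_isUnit_sub (sub_ne_zero.2 (ha i hi k hk hik)).isUnit).pow
      · have h1 : (X - C (a i)) ^ 2 ∣
            (C ((Z i).eval (a i))⁻¹ * Z i + C (β i) * ((X - C (a i)) * Z i)) - 1 := by
          apply sq_dvd_of_eval_derivative
          · simp [hZ0 i hi]
          · have := hZ0 i hi
            simp only [derivative_sub, derivative_add, derivative_mul, derivative_C, derivative_X,
              derivative_one, eval_sub, eval_add, eval_mul, eval_C, eval_X, eval_one, eval_zero,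
              hZd i hi, hβ]
            field_simp
            ring
        have h2 : T - 1 = ((C ((Z i).eval (a i))⁻¹ * Z i + C (β i) * ((X - C (a i)) * Z i)) - 1)
            + (∑ k ∈ s.erase i,
              (C ((Z k).eval (a k))⁻¹ * Z k + C (β k) * ((X - C (a k)) * Z k)) +
              ∑ j ∈ t, C ((W j).eval (b j))⁻¹ * W j) := by
          rw [hT, ← add_sum_erase s _ hi]; ring
        rw [h2]
        refine dvd_add h1 (dvd_add (dvd_sum fun k hk => ?_) (dvd_sum fun j hj => ?_))
        · have := dvdZ i hi k (mem_of_mem_erase hk) (ne_of_mem_erase hk)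
          exact dvd_add (this.mul_left _) ((this.mul_left _).mul_left _)
        · exact (dvdW i hi j).mul_left _
    · refine Finset.prod_dvd_of_coprime (fun i hi k hk hik => ?_) fun i hi => ?_
      · exact isCoprime_X_sub_C_of_isUnit_sub (sub_ne_zero.2 (hb i hi k hk hik)).isUnit
      · have h1 : (X - C (b i)) ∣ C ((W i).eval (b i))⁻¹ * W i - 1 := by
          rw [dvd_iff_isRoot]
          simp [hW0 i hi]
        have h2 : T - 1 = (C ((W i).eval (b i))⁻¹ * W i - 1)
            + (∑ k ∈ s, (C ((Z k).eval (a k))⁻¹ * Z k + C (β k) * ((X - C (a k)) * Z k)) +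
              ∑ j ∈ t.erase i, C ((W j).eval (b j))⁻¹ * W j) := by
          rw [hT, ← add_sum_erase t _ hi]; ring
        rw [h2]
        refine dvd_add h1 (dvd_add (dvd_sum fun k hk => ?_) (dvd_sum fun j hj => ?_))
        · have := dvdZb i hi k
          exact dvd_add (this.mul_left _) ((this.mul_left _).mul_left _)
        · exact (dvdWb i hi j (mem_of_mem_erase hj) (ne_of_mem_erase hj)).mul_left _
  have hXZ : ∀ i, ((X - C (a i)) * Z i).Monic := fun i => (monic_X_sub_C _).mul (hZm i)
  have dXZ : ∀ i, ((X - C (a i)) * Z i).natDegree = (Z i).natDegree + 1 := by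
    intro i
    rw [(monic_X_sub_C _).natDegree_mul (hZm i)]; simp; ring
  have hdeg : (T - 1).natDegree ≤ Q.natDegree - 1 := by
    refine (natDegree_sub_le _ _).trans (max_le ?_ (by simp))
    refine (natDegree_add_le _ _).trans (max_le ?_ ?_)
    · refine natDegree_sum_le_of_forall_le _ _ fun i hi => ?_
      refine (natDegree_add_le _ _).trans (max_le ?_ ?_)
      · refine (natDegree_C_mul_le _ _).trans ?_
        rw [dQZ i hi]; omega
      · refine (natDegree_C_mul_le _ _).trans ?_
        rw [dXZ i, dQZ i hi]; omega
    · refine natDegree_sum_le_of_forall_le _ _ fun i hi => ?_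
      refine (natDegree_C_mul_le _ _).trans ?_
      rw [dQW i hi]; omega
  have hT1 : T - 1 = 0 := by
    by_contra hne
    have := natDegree_le_of_dvd hdvd hne
    omega
  -- In degree `deg Q - 1` the coefficient of `T` is exactly the sum of residues, while that of `1`
  -- is zero because `deg Q ≥ 2`.
  have hc := congrArg (fun P : ℂ[X] => P.coeff (Q.natDegree - 1)) hT1
  simp only [hT, coeff_sub, coeff_add, finsetSum_coeff, coeff_C_mul, coeff_zero] at hc
  rw [coeff_one, if_neg (by omega), sub_zero] at hc
  rw [← hc]
  congr 1
  · refine sum_congr rfl fun i hi => ?_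
    have e1 : (Z i).coeff (Q.natDegree - 1) = 0 :=
      coeff_eq_zero_of_natDegree_lt (by rw [dQZ i hi]; omega)
    have e2 : ((X - C (a i)) * Z i).coeff (Q.natDegree - 1) = 1 := by
      have := (hXZ i).coeff_natDegree
      rwa [dXZ i, show (Z i).natDegree + 1 = Q.natDegree - 1 by rw [dQZ i hi]; omega] at this
    rw [e1, e2, hβ]
    simp only [hZe]
    ring
  · refine sum_congr rfl fun j hj => ?_
    have e2 : (W j).coeff (Q.natDegree - 1) = 1 := by
      have := (hWm j).coeff_natDegree
      rwa [show (W j).natDegree = Q.natDegree - 1 by rw [dQW j hj]; omega] at this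
    rw [e2, hWe, mul_one]

end Residues

/-! ### Partial fractions and residues in the variable `y = x + 1/x` -/

section Nodes

open Finset

/-- The factor `(1 - p x) (1 - p / x)` as a polynomial in `y = x + 1 / x`. -/
noncomputable def nodeFactor (p y : ℂ) : ℂ := 1 - p * y + p ^ 2

theorem nodeFactor_node (p : ℂ) {r : ℂ} (hr : r ≠ 0) :
    nodeFactor p (r + r⁻¹) = (1 - p * r) * (1 - p / r) := by
  unfold nodeFactor
  field_simp
  ring

theorem nodeFactor_eq {p : ℂ} (hp : p ≠ 0) (y : ℂ) :
    nodeFactor p y = -p * (y - (p + p⁻¹)) := by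
  unfold nodeFactor
  field_simp
  ring

theorem nodeFactor_neg_node (p : ℂ) {r : ℂ} :
    nodeFactor p (-r + (-r)⁻¹) = nodeFactor (-p) (r + r⁻¹) := by
  unfold nodeFactor
  rw [inv_neg]
  ring

/-- Splits the logarithmic derivative in `y` into two sums of geometric type, which cancel almost
entirely when `p` runs over powers of `q`. -/
theorem div_nodeFactor_node {p r : ℂ} (hr : r ≠ 0) (hr2 : 1 - r ^ 2 ≠ 0) (h1 : 1 - p * r ≠ 0)
    (h2 : 1 - p / r ≠ 0) :
    p / nodeFactor p (r + r⁻¹) = r / (1 - r ^ 2) * (1 / (1 - p / r) - 1 / (1 - p * r)) := by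
  rw [nodeFactor_node p hr]
  have h3 : r - p ≠ 0 := by
    intro h
    apply h2
    rw [show p = r by linear_combination -h, div_self hr, sub_self]
  have : 1 - p / r = (r - p) / r := by field_simp
  rw [this]
  field_simp
  ring

/-- The Lagrange basis polynomials at the nodes `p i + 1 / p i` sum to `1`; dividing by the full
product gives the partial fraction expansion. -/
theorem inv_prod_nodeFactor {s : Finset ℕ} (hs : s.Nonempty) {p : ℕ → ℂ} (hp : ∀ i ∈ s, p i ≠ 0)
    (h : ∀ i ∈ s, ∀ k ∈ s, k ≠ i → nodeFactor (p k) (p i + (p i)⁻¹) ≠ 0) {y : ℂ}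
    (hy : ∀ i ∈ s, nodeFactor (p i) y ≠ 0) :
    (∏ k ∈ s, nodeFactor (p k) y)⁻¹ =
      ∑ i ∈ s, (∏ k ∈ s.erase i, nodeFactor (p k) (p i + (p i)⁻¹))⁻¹ *
        (nodeFactor (p i) y)⁻¹ := by
  have hinj : Set.InjOn (fun i => p i + (p i)⁻¹) s := by
    intro i hi k hk hik
    by_contra hne
    apply h i hi k hk (fun h => hne h.symm)
    rw [nodeFactor_eq (hp k hk)]
    simp only at hik
    rw [hik, sub_self, mul_zero]
  have hL := congrArg (Polynomial.eval y) (Lagrange.sum_basis hinj hs)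
  simp only [eval_finsetSum, eval_one] at hL
  rw [inv_eq_one_div, div_eq_iff (prod_ne_zero_iff.2 hy), ← hL, sum_mul]
  refine sum_congr rfl fun i hi => ?_
  rw [← mul_prod_erase s _ hi, Lagrange.basis, eval_prod]
  have e : ∀ k ∈ s.erase i, eval y (Lagrange.basisDivisor (p i + (p i)⁻¹) (p k + (p k)⁻¹)) =
      (nodeFactor (p k) (p i + (p i)⁻¹))⁻¹ * nodeFactor (p k) y := by
    intro k hk
    have h1 := hp k (mem_of_mem_erase hk)
    have h2 := h i hi k (mem_of_mem_erase hk) (ne_of_mem_erase hk)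
    rw [nodeFactor_eq h1] at h2 ⊢
    rw [nodeFactor_eq h1]
    simp only [Lagrange.basisDivisor, eval_mul, eval_C, eval_sub, eval_X]
    have h3 := right_ne_zero_of_mul h2
    rw [mul_inv]
    field_simp
  rw [prod_congr rfl e, prod_mul_distrib, prod_inv_distrib]
  have := hy i hi
  field_simp

theorem sum_residues_nodeFactor_eq_zero {s t : Finset ℕ} {p σ : ℕ → ℂ} (hs : s.Nonempty)
    (hp : ∀ i ∈ s, p i ≠ 0) (hσ : ∀ j ∈ t, σ j ≠ 0)
    (ha : ∀ i ∈ s, ∀ k ∈ s, k ≠ i → nodeFactor (p k) (p i + (p i)⁻¹) ≠ 0)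
    (hb : ∀ i ∈ t, ∀ k ∈ t, k ≠ i → nodeFactor (σ k) (σ i + (σ i)⁻¹) ≠ 0)
    (hab : ∀ i ∈ s, ∀ j ∈ t, nodeFactor (σ j) (p i + (p i)⁻¹) ≠ 0) :
    ∑ i ∈ s, ((p i) ^ 2 * ((∏ k ∈ s.erase i, nodeFactor (p k) (p i + (p i)⁻¹)) ^ 2 *
        ∏ j ∈ t, nodeFactor (σ j) (p i + (p i)⁻¹)))⁻¹ *
        (2 * ∑ k ∈ s.erase i, p k / nodeFactor (p k) (p i + (p i)⁻¹) +
          ∑ j ∈ t, σ j / nodeFactor (σ j) (p i + (p i)⁻¹)) -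
      ∑ j ∈ t, (σ j * ((∏ k ∈ s, nodeFactor (p k) (σ j + (σ j)⁻¹)) ^ 2 *
        ∏ i ∈ t.erase j, nodeFactor (σ i) (σ j + (σ j)⁻¹)))⁻¹ = 0 := by
  have aux : ∀ {u v : ℂ}, u ≠ 0 → nodeFactor u (v + v⁻¹) ≠ 0 → v + v⁻¹ ≠ u + u⁻¹ := by
    intro u v hu h e
    rw [nodeFactor_eq hu, e, sub_self, mul_zero] at h
    exact h rfl
  have key := sum_residues_eq_zero (s := s) (t := t) (a := fun i => p i + (p i)⁻¹)
    (b := fun j => σ j + (σ j)⁻¹) hs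
    (fun i hi k hk hik => aux (hp k hk) (ha i hi k hk hik.symm))
    (fun i hi k hk hik => aux (hσ k hk) (hb i hi k hk hik.symm))
    (fun i hi j hj => aux (hσ j hj) (hab i hi j hj))
  -- The leading coefficient of `∏ nodeFactor (p k) y ^ 2 * ∏ nodeFactor (σ j) y`, by which the
  -- monic denominator has to be rescaled.
  set K : ℂ := (∏ k ∈ s, (p k) ^ 2) * ∏ j ∈ t, (-σ j) with hK
  have key2 := congrArg (fun z => K⁻¹ * z) key
  simp only [mul_zero] at key2
  rw [mul_add, mul_sum, mul_sum] at key2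
  rw [← key2, sub_eq_add_neg, ← sum_neg_distrib]
  congr 1
  · refine sum_congr rfl fun i hi => ?_
    have e1 : ∀ k ∈ s.erase i, nodeFactor (p k) (p i + (p i)⁻¹) =
        -p k * ((p i + (p i)⁻¹) - (p k + (p k)⁻¹)) := fun k hk =>
      nodeFactor_eq (hp k (mem_of_mem_erase hk)) _
    have e2 : ∀ j ∈ t, nodeFactor (σ j) (p i + (p i)⁻¹) =
        -σ j * ((p i + (p i)⁻¹) - (σ j + (σ j)⁻¹)) := fun j hj => nodeFactor_eq (hσ j hj) _
    have e3 : 2 * ∑ k ∈ s.erase i, p k / nodeFactor (p k) (p i + (p i)⁻¹) =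
        -∑ k ∈ s.erase i, 2 / ((p i + (p i)⁻¹) - (p k + (p k)⁻¹)) := by
      rw [mul_sum, ← sum_neg_distrib]
      refine sum_congr rfl fun k hk => ?_
      rw [e1 k hk]
      have := hp k (mem_of_mem_erase hk)
      rw [neg_mul, div_neg, div_mul_eq_div_div, div_self this]
      ring
    have e4 : ∑ j ∈ t, σ j / nodeFactor (σ j) (p i + (p i)⁻¹) =
        -∑ j ∈ t, 1 / ((p i + (p i)⁻¹) - (σ j + (σ j)⁻¹)) := by
      rw [← sum_neg_distrib]
      refine sum_congr rfl fun k hk => ?_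
      rw [e2 k hk]
      have := hσ k hk
      rw [neg_mul, div_neg, div_mul_eq_div_div, div_self this]
    rw [e3, e4, prod_congr rfl e1, prod_congr rfl e2, prod_mul_distrib, prod_mul_distrib,
      hK, ← mul_prod_erase s _ hi, prod_pow, prod_pow]
    have e5 : (∏ k ∈ s.erase i, -p k) ^ 2 = (∏ k ∈ s.erase i, p k) ^ 2 := by
      rw [← prod_pow, ← prod_pow]
      exact prod_congr rfl fun k _ => by ring
    rw [mul_pow, e5]
    simp only [mul_inv]
    ring
  · refine sum_congr rfl fun j hj => ?_
    have e1 : ∀ k ∈ s, nodeFactor (p k) (σ j + (σ j)⁻¹) =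
        -p k * ((σ j + (σ j)⁻¹) - (p k + (p k)⁻¹)) := fun k hk => nodeFactor_eq (hp k hk) _
    have e2 : ∀ i ∈ t.erase j, nodeFactor (σ i) (σ j + (σ j)⁻¹) =
        -σ i * ((σ j + (σ j)⁻¹) - (σ i + (σ i)⁻¹)) := fun i hi =>
      nodeFactor_eq (hσ i (mem_of_mem_erase hi)) _
    rw [prod_congr rfl e1, prod_congr rfl e2, prod_mul_distrib, prod_mul_distrib,
      hK, ← mul_prod_erase t _ hj, prod_pow, prod_pow]
    have e5 : (∏ k ∈ s, -p k) ^ 2 = (∏ k ∈ s, p k) ^ 2 := by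
      rw [← prod_pow, ← prod_pow]
      exact prod_congr rfl fun k _ => by ring
    rw [mul_pow, e5, ← inv_neg]
    simp only [← mul_inv]
    congr 1
    ring

end Nodes

/-! ### Closed forms of the node products -/

section ClosedForms

open Finset

/-- The triangular number `0 + 1 + ⋯ + n`. -/
def tri (n : ℕ) : ℕ := n * (n + 1) / 2

theorem two_mul_tri (n : ℕ) : 2 * tri n = n * (n + 1) :=
  Nat.mul_div_cancel' (Nat.even_mul_succ_self n).two_dvd

theorem tri_succ (n : ℕ) : tri (n + 1) = tri n + (n + 1) := by
  have h1 := two_mul_tri n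
  have h2 := two_mul_tri (n + 1)
  nlinarith

theorem sq_pow_tri (q : ℂ) (n : ℕ) : (q ^ 2) ^ tri n = q ^ (n * (n + 1)) := by
  rw [← pow_mul, two_mul_tri]

theorem prod_erase_range (f : ℕ → ℂ) (n M : ℕ) :
    ∏ k ∈ (range (n + M + 1)).erase n, f k =
      (∏ k ∈ range n, f k) * ∏ m ∈ range M, f (n + 1 + m) := by
  have : (range (n + M + 1)).erase n = range n ∪ (range M).map (addLeftEmbedding (n + 1)) := by
    ext k
    simp only [mem_erase, mem_range, mem_union, Finset.mem_map, addLeftEmbedding_apply]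
    constructor
    · rintro ⟨h1, h2⟩
      rcases lt_or_ge k n with h | h
      · exact Or.inl h
      · exact Or.inr ⟨k - (n + 1), by omega, by omega⟩
    · rintro (h | ⟨m, hm, rfl⟩) <;> omega
  rw [this, prod_union, prod_map]
  · rfl
  · rw [disjoint_left]
    intro k hk
    simp only [mem_range, Finset.mem_map, addLeftEmbedding_apply, not_exists, not_and] at hk ⊢
    omega

theorem sum_erase_range (f : ℕ → ℂ) (n M : ℕ) :
    ∑ k ∈ (range (n + M + 1)).erase n, f k =
      (∑ k ∈ range n, f k) + ∑ m ∈ range M, f (n + 1 + m) := by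
  have h1 := sum_erase_eq_sub (f := f) (show n ∈ range (n + M + 1) by simp)
  rw [h1, show n + M + 1 = (n + 1) + M by ring, sum_range_add, sum_range_succ]
  ring

variable {Q : ℂ}

/-- Reversing the product turns the factors into `1 - c / Q^(j+1)`; clearing these denominators
costs `Q^(1 + ⋯ + n)`. -/
theorem prod_one_sub_mul_pow_div (hQ : Q ≠ 0) (c : ℂ) (n : ℕ) :
    (∏ k ∈ range n, (1 - c * Q ^ k / Q ^ n)) * Q ^ tri n = ∏ k ∈ range n, (Q ^ (k + 1) - c) := by
  rw [← prod_range_reflect]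
  have : ∏ j ∈ range n, (1 - c * Q ^ (n - 1 - j) / Q ^ n) =
      ∏ j ∈ range n, (1 - c / Q ^ (j + 1)) := by
    refine prod_congr rfl fun j hj => ?_
    rw [mem_range] at hj
    rw [show Q ^ n = Q ^ (n - 1 - j) * Q ^ (j + 1) by rw [← pow_add]; congr 1; omega]
    field_simp
  rw [this]
  clear this
  induction n with
  | zero => simp [tri]
  | succ n ih =>
    rw [prod_range_succ, prod_range_succ, tri_succ, pow_add _ (tri n), ← ih]
    have h : (1 - c / Q ^ (n + 1)) * Q ^ (n + 1) = Q ^ (n + 1) - c := by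
      have := pow_ne_zero (n + 1) hQ
      field_simp
    rw [← h]
    ring

theorem prod_one_sub_pow_div (hQ : Q ≠ 0) (n : ℕ) :
    (∏ k ∈ range n, (1 - Q ^ k / Q ^ n)) * Q ^ tri n = (-1) ^ n * qPoch Q Q n := by
  have := prod_one_sub_mul_pow_div hQ 1 n
  simp only [one_mul] at this
  rw [this, qPoch, ← card_range n, ← prod_const, card_range, ← prod_mul_distrib]
  exact prod_congr rfl fun k _ => by ring

theorem prod_one_add_pow_div (hQ : Q ≠ 0) (n : ℕ) :
    (∏ k ∈ range n, (1 + Q ^ k / Q ^ n)) * Q ^ tri n = qPoch (-Q) Q n := by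
  have := prod_one_sub_mul_pow_div hQ (-1) n
  rw [qPoch, ← prod_congr rfl fun k _ => (show (Q ^ (k + 1) - -1) = 1 - -Q * Q ^ k by ring),
    ← this]
  congr 1
  exact prod_congr rfl fun k _ => by ring

theorem prod_one_add_mul_sq_pow_div {q : ℂ} (hq : q ≠ 0) (n : ℕ) :
    (∏ k ∈ range n, (1 + q * (q ^ 2) ^ k / (q ^ 2) ^ n)) * q ^ n ^ 2 = qPoch (-q) (q ^ 2) n := by
  have h := prod_one_sub_mul_pow_div (pow_ne_zero 2 hq) (-q) n
  have e : ∏ k ∈ range n, ((q ^ 2) ^ (k + 1) - -q) = q ^ n * qPoch (-q) (q ^ 2) n := by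
    have e0 : q ^ n = ∏ _k ∈ range n, q := by simp
    rw [qPoch, e0, ← prod_mul_distrib]
    exact prod_congr rfl fun k _ => by ring
  rw [e, sq_pow_tri, show n * (n + 1) = n + n ^ 2 by ring, pow_add] at h
  have h2 : ∏ k ∈ range n, (1 - -q * (q ^ 2) ^ k / (q ^ 2) ^ n) =
      ∏ k ∈ range n, (1 + q * (q ^ 2) ^ k / (q ^ 2) ^ n) :=
    prod_congr rfl fun k _ => by ring
  rw [h2] at h
  have := pow_ne_zero n hq
  apply mul_left_cancel₀ this
  rw [← h]
  ring

theorem prod_one_sub_pow_add_div (hQ : Q ≠ 0) (n M : ℕ) :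
    ∏ m ∈ range M, (1 - Q ^ (n + 1 + m) / Q ^ n) = qPoch Q Q M := by
  rw [qPoch]
  refine prod_congr rfl fun m _ => ?_
  have := pow_ne_zero n hQ
  rw [pow_add, pow_add]
  field_simp

/-- The factors `1 - Q^(k-n)` give `(Q)_n (Q)_M` up to sign and power. The factors `1 - Q^(k+n)` run
from exponent `n` to `2n + M` with `2n` skipped, and `(1 - Q^n) / (1 - Q^(2n))` leaves the
denominator `1 + Q^n`. At `n = 0` both skipped factors coincide and the formula would be off by a
factor 2. -/
theorem prod_erase_nodeFactor_pow (hQ : Q ≠ 0) (hQ1 : ‖Q‖ < 1) {n : ℕ} (hn : n ≠ 0) (M : ℕ) :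
    (∏ k ∈ (range (n + M + 1)).erase n, nodeFactor (Q ^ k) (Q ^ n + (Q ^ n)⁻¹)) =
      (-1) ^ n * (qPoch Q Q M * qPoch Q Q (M + 2 * n)) / (Q ^ tri n * (1 + Q ^ n)) := by
  have hn' := pow_ne_zero n hQ
  have h1 := one_add_pow_ne_zero hQ1 n
  simp only [nodeFactor_node _ hn']
  rw [eq_div_iff (mul_ne_zero (pow_ne_zero _ hQ) h1), prod_mul_distrib, prod_erase_range,
    prod_erase_range, prod_one_sub_pow_add_div hQ]
  have key : ((∏ k ∈ range n, (1 - Q ^ k * Q ^ n)) * ∏ m ∈ range M, (1 - Q ^ (n + 1 + m) * Q ^ n))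
      * (1 + Q ^ n) * qPoch Q Q n = qPoch Q Q (M + 2 * n) := by
    obtain ⟨l, rfl⟩ : ∃ l, n = l + 1 := ⟨n - 1, by omega⟩
    rw [show M + 2 * (l + 1) = l + (l + 1) + 1 + M by ring, qPoch_add Q Q _ M,
      qPoch_succ Q Q (l + (l + 1)), qPoch_add Q Q l (l + 1), qPoch_succ Q Q l]
    have e1 : ∏ k ∈ range (l + 1), (1 - Q ^ k * Q ^ (l + 1)) = qPoch (Q * Q ^ l) Q (l + 1) :=
      prod_congr rfl fun k _ => by ring
    have e2 : ∏ m ∈ range M, (1 - Q ^ (l + 1 + 1 + m) * Q ^ (l + 1)) =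
        qPoch (Q * Q ^ (l + (l + 1) + 1)) Q M :=
      prod_congr rfl fun k _ => by ring
    rw [e1, e2]
    ring
  have h3 := prod_one_sub_pow_div hQ n
  rw [← key]
  linear_combination ((∏ k ∈ range n, (1 - Q ^ k * Q ^ n)) *
    ∏ m ∈ range M, (1 - Q ^ (n + 1 + m) * Q ^ n)) * qPoch Q Q M * (1 + Q ^ n) * h3

/-- The factor 2 is `1 + Q^0`, from `k = n`; the factor `1 + Q^n` is the first of the increasing run
`1 + Q^(k+n)`, which `(-Q)_n` already contains when `n ≠ 0`. -/
theorem prod_nodeFactor_neg_pow (hQ : Q ≠ 0) (hQ1 : ‖Q‖ < 1) (n M : ℕ) :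
    (∏ k ∈ range (n + M + 1), nodeFactor (-Q ^ k) (Q ^ n + (Q ^ n)⁻¹)) =
      2 * (1 + Q ^ n) * (qPoch (-Q) Q M * qPoch (-Q) Q (M + 2 * n)) / Q ^ tri n := by
  have hn' := pow_ne_zero n hQ
  simp only [nodeFactor_node _ hn']
  rw [eq_div_iff (pow_ne_zero _ hQ), prod_mul_distrib]
  have e1 : (∏ k ∈ range (n + M + 1), (1 - -Q ^ k * Q ^ n)) * qPoch (-Q) Q n =
      (1 + Q ^ n) * qPoch (-Q) Q (M + 2 * n) := by
    rw [show M + 2 * n = n + (n + M) by ring, qPoch_add, prod_range_succ']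
    have : ∏ k ∈ range (n + M), (1 - -Q ^ (k + 1) * Q ^ n) = qPoch (-Q * Q ^ n) Q (n + M) :=
      prod_congr rfl fun k _ => by ring
    rw [this]
    ring
  have e2 : (∏ k ∈ range (n + M + 1), (1 - -Q ^ k / Q ^ n)) * Q ^ tri n =
      2 * (qPoch (-Q) Q n * qPoch (-Q) Q M) := by
    rw [show n + M + 1 = n + (M + 1) by ring, prod_range_add, prod_range_succ' _ M,
      ← prod_one_add_pow_div hQ n]
    have t1 : ∏ x ∈ range n, (1 - -Q ^ x / Q ^ n) = ∏ k ∈ range n, (1 + Q ^ k / Q ^ n) :=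
      prod_congr rfl fun k _ => by ring
    have t2 : ∏ k ∈ range M, (1 - -Q ^ (n + (k + 1)) / Q ^ n) = qPoch (-Q) Q M :=
      prod_congr rfl fun k _ => by rw [pow_add]; field_simp; ring
    rw [t1, t2, add_zero, neg_div, div_self hn']
    ring
  have h0 : qPoch (-Q) Q n ≠ 0 := qPoch_ne_zero (neg_self_mul_pow_ne_one hQ1) n
  apply mul_left_cancel₀ h0
  linear_combination (qPoch (-Q) Q n * ∏ k ∈ range (n + M + 1), (1 - -Q ^ k * Q ^ n)) * e2 +
    2 * (qPoch (-Q) Q n * qPoch (-Q) Q M) * e1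

variable {q : ℂ}

theorem prod_nodeFactor_neg_odd_pow (hq : q ≠ 0) (hq1 : ‖q‖ < 1) (n M : ℕ) :
    (∏ k ∈ range (n + M + 1), nodeFactor (-(q * (q ^ 2) ^ k)) ((q ^ 2) ^ n + ((q ^ 2) ^ n)⁻¹)) =
      qPoch (-q) (q ^ 2) (M + 1) * qPoch (-q) (q ^ 2) (M + 1 + 2 * n) / q ^ n ^ 2 := by
  have hn' := pow_ne_zero n (pow_ne_zero 2 hq)
  simp only [nodeFactor_node _ hn']
  rw [eq_div_iff (pow_ne_zero _ hq), prod_mul_distrib]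
  have e1 : (∏ k ∈ range (n + M + 1), (1 - -(q * (q ^ 2) ^ k) * (q ^ 2) ^ n)) *
      qPoch (-q) (q ^ 2) n = qPoch (-q) (q ^ 2) (M + 1 + 2 * n) := by
    rw [show M + 1 + 2 * n = n + (n + M + 1) by ring, qPoch_add, mul_comm]
    congr 1
    exact prod_congr rfl fun k _ => by ring
  have e2 : (∏ k ∈ range (n + M + 1), (1 - -(q * (q ^ 2) ^ k) / (q ^ 2) ^ n)) * q ^ n ^ 2 =
      qPoch (-q) (q ^ 2) n * qPoch (-q) (q ^ 2) (M + 1) := by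
    rw [show n + M + 1 = n + (M + 1) by ring, prod_range_add,
      ← prod_one_add_mul_sq_pow_div hq n]
    have t1 : ∏ x ∈ range n, (1 - -(q * (q ^ 2) ^ x) / (q ^ 2) ^ n) =
        ∏ k ∈ range n, (1 + q * (q ^ 2) ^ k / (q ^ 2) ^ n) :=
      prod_congr rfl fun k _ => by ring
    have t2 : ∏ k ∈ range (M + 1), (1 - -(q * (q ^ 2) ^ (n + k)) / (q ^ 2) ^ n) =
        qPoch (-q) (q ^ 2) (M + 1) :=
      prod_congr rfl fun k _ => by rw [pow_add]; field_simp
    rw [t1, t2]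
    ring
  have h0 : qPoch (-q) (q ^ 2) n ≠ 0 := qPoch_ne_zero (neg_mul_sq_pow_ne_one hq1) n
  apply mul_left_cancel₀ h0
  linear_combination (qPoch (-q) (q ^ 2) n *
    ∏ k ∈ range (n + M + 1), (1 - -(q * (q ^ 2) ^ k) * (q ^ 2) ^ n)) * e2 +
    (qPoch (-q) (q ^ 2) n * qPoch (-q) (q ^ 2) (M + 1)) * e1

/-- The decreasing run yields `(-q; q²)_{j+1}` while the increasing run only divides by `(-q;
q²)_j`; the surplus is the factor `1 + q^(2j+1)`. -/
theorem prod_nodeFactor_at_odd_pow (hq : q ≠ 0) (hq1 : ‖q‖ < 1) (j M : ℕ) :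
    (∏ k ∈ range (j + M + 1), nodeFactor ((q ^ 2) ^ k)
      (-(q * (q ^ 2) ^ j) + (-(q * (q ^ 2) ^ j))⁻¹)) =
      (1 + q ^ (2 * j + 1)) * (qPoch (-q) (q ^ 2) M * qPoch (-q) (q ^ 2) (M + 2 * j + 1)) /
        q ^ (j + 1) ^ 2 := by
  have hj : q * (q ^ 2) ^ j ≠ 0 := mul_ne_zero hq (pow_ne_zero _ (pow_ne_zero 2 hq))
  have hj' := pow_ne_zero (j + 1) (pow_ne_zero 2 hq)
  simp only [nodeFactor_neg_node, nodeFactor_node _ hj]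
  rw [eq_div_iff (pow_ne_zero _ hq), prod_mul_distrib]
  have e1 : (∏ k ∈ range (j + M + 1), (1 - -(q ^ 2) ^ k * (q * (q ^ 2) ^ j))) *
      qPoch (-q) (q ^ 2) j = qPoch (-q) (q ^ 2) (M + 2 * j + 1) := by
    rw [show M + 2 * j + 1 = j + (j + M + 1) by ring, qPoch_add, mul_comm]
    congr 1
    exact prod_congr rfl fun k _ => by ring
  have e2 : (∏ k ∈ range (j + M + 1), (1 - -(q ^ 2) ^ k / (q * (q ^ 2) ^ j))) *
      q ^ (j + 1) ^ 2 =
      qPoch (-q) (q ^ 2) (j + 1) * qPoch (-q) (q ^ 2) M := by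
    rw [show j + M + 1 = (j + 1) + M by ring, prod_range_add,
      ← prod_one_add_mul_sq_pow_div hq (j + 1)]
    have t1 : ∏ x ∈ range (j + 1), (1 - -(q ^ 2) ^ x / (q * (q ^ 2) ^ j)) =
        ∏ k ∈ range (j + 1), (1 + q * (q ^ 2) ^ k / (q ^ 2) ^ (j + 1)) :=
      prod_congr rfl fun k _ => by field_simp; ring
    have t2 : ∏ k ∈ range M, (1 - -(q ^ 2) ^ (j + 1 + k) / (q * (q ^ 2) ^ j)) =
        qPoch (-q) (q ^ 2) M :=
      prod_congr rfl fun k _ => by field_simp; ring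
    rw [t1, t2]
    ring
  have h0 : qPoch (-q) (q ^ 2) j ≠ 0 := qPoch_ne_zero (neg_mul_sq_pow_ne_one hq1) j
  apply mul_left_cancel₀ h0
  rw [qPoch_succ (n := j)] at e2
  linear_combination (qPoch (-q) (q ^ 2) j *
    ∏ k ∈ range (j + M + 1), (1 - -(q ^ 2) ^ k * (q * (q ^ 2) ^ j))) * e2 +
    (qPoch (-q) (q ^ 2) j * (1 - -q * (q ^ 2) ^ j) * qPoch (-q) (q ^ 2) M) * e1

/-- Here the erased index skips `1 - Q^(2j+1)` with `Q = q²`. No odd power of `q` equals 1, so `j =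
0` needs no separate treatment. -/
theorem prod_erase_nodeFactor_odd_pow (hq : q ≠ 0) (hq1 : ‖q‖ < 1) (j M : ℕ) :
    (∏ k ∈ (range (j + M + 1)).erase j, nodeFactor (q * (q ^ 2) ^ k)
      (q * (q ^ 2) ^ j + (q * (q ^ 2) ^ j)⁻¹)) =
      (-1) ^ j * (qPoch (q ^ 2) (q ^ 2) M * qPoch (q ^ 2) (q ^ 2) (M + 2 * j + 1)) /
        (q ^ (j * (j + 1)) * (1 - (q ^ 2) ^ (2 * j + 1))) := by
  set Q := q ^ 2 with hQdef
  have hQ : Q ≠ 0 := pow_ne_zero 2 hq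
  have hQ1 : ‖Q‖ < 1 := norm_sq_lt_one hq1
  have hj : q * Q ^ j ≠ 0 := mul_ne_zero hq (pow_ne_zero _ hQ)
  have hj' := pow_ne_zero j hQ
  have h1 := one_sub_pow_ne_zero hQ1 (show 2 * j + 1 ≠ 0 by omega)
  simp only [nodeFactor_node _ hj]
  rw [eq_div_iff (mul_ne_zero (pow_ne_zero _ hq) h1), prod_mul_distrib, prod_erase_range,
    prod_erase_range]
  have t1 : ∏ k ∈ range j, (1 - q * Q ^ k / (q * Q ^ j)) = ∏ k ∈ range j, (1 - Q ^ k / Q ^ j) :=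
    prod_congr rfl fun k _ => by rw [mul_div_mul_left _ _ hq]
  have t2 : ∏ m ∈ range M, (1 - q * Q ^ (j + 1 + m) / (q * Q ^ j)) = qPoch Q Q M := by
    rw [← prod_one_sub_pow_add_div hQ j M]
    exact prod_congr rfl fun k _ => by rw [mul_div_mul_left _ _ hq]
  have key : ((∏ k ∈ range j, (1 - q * Q ^ k * (q * Q ^ j))) *
      ∏ m ∈ range M, (1 - q * Q ^ (j + 1 + m) * (q * Q ^ j))) *
      (1 - Q ^ (2 * j + 1)) * qPoch Q Q j = qPoch Q Q (M + 2 * j + 1) := by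
    rw [show M + 2 * j + 1 = j + j + 1 + M by ring, qPoch_add Q Q _ M,
      qPoch_succ Q Q (j + j), qPoch_add Q Q j]
    have e1 : ∏ k ∈ range j, (1 - q * Q ^ k * (q * Q ^ j)) = qPoch (Q * Q ^ j) Q j :=
      prod_congr rfl fun k _ => by rw [hQdef]; ring
    have e2 : ∏ m ∈ range M, (1 - q * Q ^ (j + 1 + m) * (q * Q ^ j)) =
        qPoch (Q * Q ^ (j + j + 1)) Q M :=
      prod_congr rfl fun k _ => by rw [hQdef]; ring
    rw [e1, e2]
    ring
  have h3 := prod_one_sub_pow_div hQ j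
  rw [show Q ^ tri j = q ^ (j * (j + 1)) from sq_pow_tri q j] at h3
  rw [t1, t2, ← key]
  linear_combination ((∏ k ∈ range j, (1 - q * Q ^ k * (q * Q ^ j))) *
    ∏ m ∈ range M, (1 - q * Q ^ (j + 1 + m) * (q * Q ^ j))) * qPoch Q Q M *
    (1 - Q ^ (2 * j + 1)) * h3

end ClosedForms

/-! ### Durfee rectangles and the limiting Bailey lemma -/

section Cauchy

variable {q : ℂ}

theorem norm_pow_le_of_le (hq : ‖q‖ < 1) {m n : ℕ} (h : m ≤ n) : ‖q ^ n‖ ≤ ‖q‖ ^ m := by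
  rw [norm_pow]
  exact pow_le_pow_of_le_one (norm_nonneg q) hq.le h

/-- The summand of Cauchy's expansion of `1 / (q; q)_∞` by Durfee rectangles. -/
noncomputable def durfeeTerm (q : ℂ) (s m : ℕ) : ℂ :=
  q ^ (m * (m + s)) / (qPoch q q m * qPoch q q (m + s))

theorem exists_norm_durfeeTerm_le (hq : ‖q‖ < 1) :
    ∃ C : ℝ, 0 ≤ C ∧ ∀ s m, ‖durfeeTerm q s m‖ ≤ C * ‖q‖ ^ m := by
  obtain ⟨C, hC0, hC⟩ := exists_norm_inv_qPoch_le hq (self_mul_pow_ne_one hq)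
  refine ⟨C * C, mul_nonneg hC0 hC0, fun s m => ?_⟩
  rw [durfeeTerm, div_eq_mul_inv, mul_inv, norm_mul, norm_mul, mul_comm]
  refine mul_le_mul (mul_le_mul (hC _) (hC _) (norm_nonneg _) hC0) (norm_pow_le_of_le hq ?_)
    (norm_nonneg _) (mul_nonneg hC0 hC0)
  nlinarith [Nat.zero_le (m * s), Nat.le_mul_self m]

theorem summable_durfeeTerm (hq : ‖q‖ < 1) (s : ℕ) : Summable (durfeeTerm q s) := by
  obtain ⟨C, -, hC⟩ := exists_norm_durfeeTerm_le hq
  exact Summable.of_norm_bounded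
    ((summable_geometric_of_lt_one (norm_nonneg q) hq).mul_left C) (hC s)

theorem tsum_durfeeTerm_succ (hq : ‖q‖ < 1) (s : ℕ) :
    ∑' m, durfeeTerm q s m = ∑' m, durfeeTerm q (s + 1) m := by
  rw [← sub_eq_zero, ← (summable_durfeeTerm hq s).tsum_sub (summable_durfeeTerm hq (s + 1))]
  -- Telescoping certificate: `G` vanishes at `0` and at infinity.
  set G : ℕ → ℂ := fun m => (1 - q ^ m) * durfeeTerm q s m with hG
  have hne := qPoch_ne_zero (self_mul_pow_ne_one hq)
  have hterm : ∀ m, durfeeTerm q s m - durfeeTerm q (s + 1) m = G m - G (m + 1) := by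
    intro m
    simp only [hG, durfeeTerm]
    rw [show m + (s + 1) = m + s + 1 by ring, show m + 1 + s = m + s + 1 by ring,
      qPoch_succ, qPoch_succ]
    have h1 := hne m
    have h2 := hne (m + s)
    have h3 := sub_ne_zero.2 (self_mul_pow_ne_one hq m).symm
    have h4 := sub_ne_zero.2 (self_mul_pow_ne_one hq (m + s)).symm
    have e : q ^ (m + 1) = q * q ^ m := by ring
    rw [e, mul_div_assoc', mul_div_assoc',
      div_sub_div _ _ (mul_ne_zero h1 h2) (mul_ne_zero h1 (mul_ne_zero h2 h4)),
      div_sub_div _ _ (mul_ne_zero h1 h2) (mul_ne_zero (mul_ne_zero h1 h3) (mul_ne_zero h2 h4)),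
      div_eq_div_iff (by positivity) (by positivity)]
    ring
  have h0 : Tendsto (fun N => ∑ m ∈ Finset.range N, (durfeeTerm q s m - durfeeTerm q (s + 1) m))
      atTop (𝓝 0) := by
    simp only [hterm, Finset.sum_range_sub']
    have hG0 : G 0 = 0 := by simp [hG]
    have : Tendsto G atTop (𝓝 ((1 - 0) * 0)) :=
      (tendsto_const_nhds.sub (tendsto_pow_atTop_nhds_zero_of_norm_lt_one hq)).mul
        (summable_durfeeTerm hq s).tendsto_atTop_zero
    simpa [hG0] using this.neg
  exact tendsto_nhds_unique
    ((summable_durfeeTerm hq s).sub (summable_durfeeTerm hq (s + 1))).hasSum.tendsto_sum_nat h0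

/-- The sum does not depend on `s`, and as `s → ∞` only the term `m = 0` survives. -/
theorem tsum_durfeeTerm (hq : ‖q‖ < 1) (s : ℕ) :
    ∑' m, durfeeTerm q s m = (qPochInf q q)⁻¹ := by
  have hconst : ∀ s, ∑' m, durfeeTerm q s m = ∑' m, durfeeTerm q 0 m := by
    intro s
    induction s with
    | zero => rfl
    | succ s ih => rw [← tsum_durfeeTerm_succ hq, ih]
  obtain ⟨C, -, hC⟩ := exists_norm_durfeeTerm_le hq
  have hlim : Tendsto (fun s => ∑' m, durfeeTerm q s m) atTop
      (𝓝 (∑' m : ℕ, if m = 0 then (qPochInf q q)⁻¹ else 0)) := by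
    refine tendsto_tsum_of_dominated_convergence
      ((summable_geometric_of_lt_one (norm_nonneg q) hq).mul_left C) (fun m => ?_)
      (Eventually.of_forall fun s m => hC s m)
    have hinf := qPochInf_ne_zero hq (self_mul_pow_ne_one hq)
    have hpoch : Tendsto (fun s => qPoch q q (m + s)) atTop (𝓝 (qPochInf q q)) :=
      (tendsto_qPoch q hq).comp (tendsto_atTop_mono (fun s => Nat.le_add_left s m) tendsto_id)
    rcases eq_or_ne m 0 with rfl | hm
    · simpa [durfeeTerm, qPoch_zero] using hpoch.inv₀ hinf
    · have hpow : Tendsto (fun s => q ^ (m * (m + s))) atTop (𝓝 0) := by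
        refine (tendsto_pow_atTop_nhds_zero_of_norm_lt_one hq).comp
          (tendsto_atTop_mono (fun s => ?_) tendsto_id)
        have : 1 * s ≤ m * (m + s) := Nat.mul_le_mul (by omega) (by omega)
        simpa using this
      have := hpow.div (tendsto_const_nhds (x := qPoch q q m) |>.mul hpoch)
        (mul_ne_zero (qPoch_ne_zero (self_mul_pow_ne_one hq) m) hinf)
      rw [zero_div] at this
      rw [if_neg hm]
      exact this
  rw [tsum_ite_eq] at hlim
  simp only [hconst] at hlim
  rw [hconst]
  exact tendsto_nhds_unique tendsto_const_nhds hlim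

/-- The limiting case of Bailey's lemma. -/
theorem tsum_bailey (hq : ‖q‖ < 1) (d : ℕ) {g : ℕ → ℂ} {B : ℝ} (hg : ∀ k, ‖g k‖ ≤ B) :
    ∑' n : ℕ, q ^ (n * (n + d)) * ∑ k ∈ Finset.range (n + 1),
        g k / (qPoch q q (n - k) * qPoch q q (n - k + 2 * k + d)) =
      (qPochInf q q)⁻¹ * ∑' k : ℕ, g k * q ^ (k * (k + d)) := by
  -- With `n = k + m`, `n(n+d) = k(k+d) + m(m+2k+d)`. Summing first over `m` gives Durfee sums with
  -- `s = 2k + d`; summing along antidiagonals gives the left side.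
  set F : ℕ × ℕ → ℂ := fun x => g x.1 * q ^ (x.1 * (x.1 + d)) * durfeeTerm q (2 * x.1 + d) x.2
    with hF
  obtain ⟨C, hC0, hC⟩ := exists_norm_durfeeTerm_le hq
  have hB : 0 ≤ B := (norm_nonneg _).trans (hg 0)
  have hgeo := summable_geometric_of_lt_one (norm_nonneg q) hq
  have hsum : Summable F := by
    refine Summable.of_norm_bounded ((hgeo.mul_of_nonneg hgeo (fun _ => by positivity)
      (fun _ => by positivity)).mul_left (B * C)) fun x => ?_
    rw [hF, norm_mul, norm_mul]
    have h1 : ‖q ^ (x.1 * (x.1 + d))‖ ≤ ‖q‖ ^ x.1 :=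
      norm_pow_le_of_le hq (by nlinarith [Nat.zero_le (x.1 * d), Nat.le_mul_self x.1])
    calc _ ≤ (B * ‖q‖ ^ x.1) * (C * ‖q‖ ^ x.2) := by
          gcongr
          · exact hg _
          · exact hC _ _
      _ = _ := by ring
  have hfib : ∑' x, F x = (qPochInf q q)⁻¹ * ∑' k : ℕ, g k * q ^ (k * (k + d)) := by
    rw [hsum.tsum_prod, ← tsum_mul_left]
    refine tsum_congr fun k => ?_
    simp only [hF]
    rw [tsum_mul_left, tsum_durfeeTerm hq, mul_comm]
  rw [← hfib, ← (Finset.HasAntidiagonal.sigmaAntidiagonalEquivProd (A := ℕ)).tsum_eq F]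
  refine Eq.trans (tsum_congr fun n => ?_)
    ((Finset.HasAntidiagonal.sigmaAntidiagonalEquivProd (A := ℕ)).summable_iff.2 hsum).tsum_sigma.symm
  rw [tsum_fintype]
  have e1 := Finset.sum_coe_sort (Finset.HasAntidiagonal.antidiagonal n) F
  refine Eq.trans ?_ e1.symm
  rw [Finset.Nat.sum_antidiagonal_eq_sum_range_succ_mk, Finset.mul_sum]
  refine Finset.sum_congr rfl fun k hk => ?_
  obtain ⟨m, rfl⟩ : ∃ m, n = k + m := ⟨n - k, by rw [Finset.mem_range] at hk; omega⟩
  simp only [hF, durfeeTerm]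
  rw [Nat.add_sub_cancel_left, show m + (2 * k + d) = m + 2 * k + d by ring,
    show (k + m) * (k + m + d) = k * (k + d) + m * (m + 2 * k + d) by ring, pow_add]
  ring

end Cauchy

/-! ### Watson's expansions of `f(q)` and `ω(-q)` -/

section Watson

open Finset

variable {q : ℂ}

theorem nodeFactor_neg_two (p : ℂ) : nodeFactor p (-2) = (1 + p) ^ 2 := by
  unfold nodeFactor; ring

theorem prod_erase_zero_nodeFactor_pow (Q : ℂ) (M : ℕ) :
    (∏ k ∈ (range (M + 1)).erase 0, nodeFactor (Q ^ k) (Q ^ 0 + (Q ^ 0)⁻¹)) =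
      qPoch Q Q M ^ 2 := by
  have := prod_erase_range (fun k => nodeFactor (Q ^ k) (Q ^ 0 + (Q ^ 0)⁻¹)) 0 M
  rw [zero_add] at this
  rw [this, range_zero, prod_empty, one_mul, qPoch, ← prod_pow]
  refine prod_congr rfl fun k _ => ?_
  rw [nodeFactor, pow_zero, inv_one]
  ring

/-- The coefficients in Watson's expansion of the mock theta function `f`. -/
noncomputable def fCoeff (q : ℂ) (k : ℕ) : ℂ :=
  if k = 0 then 1 else 4 * (-1) ^ k * q ^ tri k / (1 + q ^ k)

/-- The coefficients in Watson's expansion of the mock theta function `ω(-q)`. -/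
noncomputable def omegaCoeff (q : ℂ) (k : ℕ) : ℂ :=
  (-1) ^ k * q ^ (k * (k + 1)) * (1 - (q ^ 2) ^ (2 * k + 1)) / (1 + q ^ (2 * k + 1)) ^ 2

theorem norm_inv_one_sub_le (hq : ‖q‖ < 1) {z : ℂ} (hz : ‖z‖ ≤ ‖q‖) :
    ‖(1 - z)⁻¹‖ ≤ (1 - ‖q‖)⁻¹ := by
  rw [norm_inv]
  refine inv_anti₀ (by linarith) ?_
  have := norm_sub_norm_le (1 : ℂ) z
  rw [norm_one] at this
  linarith

theorem norm_inv_one_add_le (hq : ‖q‖ < 1) {z : ℂ} (hz : ‖z‖ ≤ ‖q‖) :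
    ‖(1 + z)⁻¹‖ ≤ (1 - ‖q‖)⁻¹ := by
  have := norm_inv_one_sub_le hq (z := -z) (by rwa [norm_neg])
  rwa [sub_neg_eq_add] at this

theorem norm_pow_le_self (hq : ‖q‖ < 1) {k : ℕ} (hk : k ≠ 0) : ‖q ^ k‖ ≤ ‖q‖ := by
  simpa using norm_pow_le_of_le hq (Nat.one_le_iff_ne_zero.2 hk)

theorem norm_pow_le_one (hq : ‖q‖ < 1) (k : ℕ) : ‖q ^ k‖ ≤ 1 := by
  simpa using norm_pow_le_of_le hq (Nat.zero_le k)

theorem one_le_inv_one_sub_norm (hq : ‖q‖ < 1) : 1 ≤ (1 - ‖q‖)⁻¹ :=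
  (one_le_inv₀ (by linarith)).2 (by linarith [norm_nonneg q])

theorem norm_fCoeff_le (hq : ‖q‖ < 1) (k : ℕ) : ‖fCoeff q k‖ ≤ 4 * (1 - ‖q‖)⁻¹ := by
  have h1 := one_le_inv_one_sub_norm hq
  unfold fCoeff
  split_ifs with hk
  · rw [norm_one]; linarith
  · rw [div_eq_mul_inv, norm_mul, norm_mul, norm_mul, norm_pow, norm_neg, norm_one, one_pow]
    have h2 := norm_inv_one_add_le hq (norm_pow_le_self hq hk)
    have h3 := norm_pow_le_one hq (tri k)
    have h4 : ‖(4 : ℂ)‖ = 4 := by norm_num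
    rw [h4]
    calc 4 * 1 * ‖q ^ tri k‖ * ‖(1 + q ^ k)⁻¹‖ ≤ 4 * 1 * 1 * (1 - ‖q‖)⁻¹ := by gcongr
      _ = _ := by ring

theorem norm_omegaCoeff_le (hq : ‖q‖ < 1) (k : ℕ) :
    ‖omegaCoeff q k‖ ≤ 2 * ((1 - ‖q‖)⁻¹ * (1 - ‖q‖)⁻¹) := by
  unfold omegaCoeff
  have h2 := norm_inv_one_add_le hq (norm_pow_le_self hq (show 2 * k + 1 ≠ 0 by omega))
  have h3 := norm_pow_le_one hq (k * (k + 1))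
  have h4 : ‖1 - (q ^ 2) ^ (2 * k + 1)‖ ≤ 2 := by
    refine (norm_sub_le _ _).trans ?_
    have := norm_pow_le_one (norm_sq_lt_one hq) (2 * k + 1)
    rw [norm_one]; linarith
  rw [div_eq_mul_inv, norm_mul, norm_mul, norm_mul, norm_pow, norm_neg, norm_one, one_pow,
    sq (1 + _), mul_inv, norm_mul]
  have := one_le_inv_one_sub_norm hq
  calc 1 * ‖q ^ (k * (k + 1))‖ * ‖1 - (q ^ 2) ^ (2 * k + 1)‖ *
        (‖(1 + q ^ (2 * k + 1))⁻¹‖ * ‖(1 + q ^ (2 * k + 1))⁻¹‖)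
      ≤ 1 * 1 * 2 * ((1 - ‖q‖)⁻¹ * (1 - ‖q‖)⁻¹) := by gcongr
    _ = _ := by ring

theorem pow_ne_pow_of_norm_lt (hq0 : q ≠ 0) (hq : ‖q‖ < 1) {i k : ℕ} (h : k ≠ i) :
    q ^ k ≠ q ^ i := by
  intro e
  have hpos : 0 < ‖q‖ := norm_pos_iff.2 hq0
  have := congrArg norm e
  rw [norm_pow, norm_pow] at this
  exact h (pow_right_injective₀ hpos hq.ne this)

theorem nodeFactor_pow_ne_zero (hq0 : q ≠ 0) (hq : ‖q‖ < 1) {i k : ℕ} (h : k ≠ i) :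
    nodeFactor (q ^ k) (q ^ i + (q ^ i)⁻¹) ≠ 0 := by
  have hi := pow_ne_zero i hq0
  rw [nodeFactor_node _ hi, ← pow_add]
  refine mul_ne_zero (one_sub_pow_ne_zero hq (by omega)) ?_
  rw [one_sub_div hi]
  exact div_ne_zero (sub_ne_zero.2 (pow_ne_pow_of_norm_lt hq0 hq h).symm) hi

theorem odd_pow_eq (q : ℂ) (k : ℕ) : q * (q ^ 2) ^ k = q ^ (2 * k + 1) := by
  rw [← pow_mul, ← pow_succ']

/-- Partial fractions with nodes `q^k`, evaluated at `y = -2`, where each node factor becomes the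
square `(1 + q^k)^2`. This is a Bailey pair relative to `a = 1`. -/
theorem inv_qPoch_neg_sq (hq0 : q ≠ 0) (hq : ‖q‖ < 1) (n : ℕ) :
    (qPoch (-q) q n ^ 2)⁻¹ = ∑ k ∈ range (n + 1),
      fCoeff q k / (qPoch q q (n - k) * qPoch q q (n - k + 2 * k)) := by
  have key := inv_prod_nodeFactor (s := range (n + 1)) (by simp) (p := fun k => q ^ k)
    (fun i _ => pow_ne_zero i hq0) (fun i _ k _ hk => nodeFactor_pow_ne_zero hq0 hq hk) (y := -2)
    (fun i _ => by rw [nodeFactor_neg_two]; exact pow_ne_zero 2 (one_add_pow_ne_zero hq i))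
  simp only [nodeFactor_neg_two] at key
  -- The node `k = 0` contributes `(1 + 1)^2 = 4`.
  have e : ∏ k ∈ range (n + 1), (1 + q ^ k) ^ 2 = 4 * qPoch (-q) q n ^ 2 := by
    rw [prod_range_succ', qPoch, prod_pow, ← prod_congr rfl fun k _ =>
      (show 1 + q ^ (k + 1) = 1 - -q * q ^ k by ring)]
    norm_num; ring
  rw [e, mul_inv] at key
  have key2 : (qPoch (-q) q n ^ 2)⁻¹ = 4 * ∑ i ∈ range (n + 1),
      (∏ k ∈ (range (n + 1)).erase i, nodeFactor (q ^ k) (q ^ i + (q ^ i)⁻¹))⁻¹ *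
        ((1 + q ^ i) ^ 2)⁻¹ := by
    rw [← key]; ring
  rw [key2, mul_sum]
  refine sum_congr rfl fun k hk => ?_
  obtain ⟨m, rfl⟩ : ∃ m, n = k + m := ⟨n - k, by rw [Finset.mem_range] at hk; omega⟩
  rw [Nat.add_sub_cancel_left]
  have h1 := qPoch_ne_zero (self_mul_pow_ne_one hq) m
  -- At `k = 0` the node is `y = 2`, where `x` and `1/x` coincide; the residue is half of what the
  -- general formula predicts, so `fCoeff q 0` is 1 and not 2.
  rcases eq_or_ne k 0 with rfl | hk0
  · rw [zero_add, prod_erase_zero_nodeFactor_pow]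
    simp only [fCoeff, if_true, mul_zero, add_zero, pow_zero]
    field_simp
    norm_num
  · have h2 := qPoch_ne_zero (self_mul_pow_ne_one hq) (m + 2 * k)
    have h3 := one_add_pow_ne_zero hq k
    have h4 := pow_ne_zero (tri k) hq0
    have h5 : ((-1 : ℂ) ^ k) * (-1) ^ k = 1 := by rw [← mul_pow]; simp
    have h6 : (-1 : ℂ) ^ k ≠ 0 := by simp
    rw [prod_erase_nodeFactor_pow hq0 hq hk0]
    simp only [fCoeff, if_neg hk0]
    field_simp
    linear_combination -h5

/-- The same expansion with nodes `q^(2k+1)`: a Bailey pair in base `q²` relative to `a = q²`, hence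
`d = 1` in `tsum_bailey`. -/
theorem inv_qPoch_neg_odd_sq (hq0 : q ≠ 0) (hq : ‖q‖ < 1) (n : ℕ) :
    (qPoch (-q) (q ^ 2) (n + 1) ^ 2)⁻¹ = ∑ k ∈ range (n + 1),
      omegaCoeff q k /
        (qPoch (q ^ 2) (q ^ 2) (n - k) * qPoch (q ^ 2) (q ^ 2) (n - k + 2 * k + 1)) := by
  have key := inv_prod_nodeFactor (s := range (n + 1)) (by simp) (p := fun k => q * (q ^ 2) ^ k)
    (fun i _ => mul_ne_zero hq0 (pow_ne_zero i (pow_ne_zero 2 hq0)))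
    (fun i _ k _ hk => by
      rw [odd_pow_eq, odd_pow_eq]
      exact nodeFactor_pow_ne_zero hq0 hq (by omega)) (y := -2)
    (fun i _ => by
      rw [nodeFactor_neg_two, odd_pow_eq]; exact pow_ne_zero 2 (one_add_pow_ne_zero hq _))
  simp only [nodeFactor_neg_two] at key
  have e : ∏ k ∈ range (n + 1), (1 + q * (q ^ 2) ^ k) ^ 2 = qPoch (-q) (q ^ 2) (n + 1) ^ 2 := by
    rw [qPoch, prod_pow]
    congr 1
    exact prod_congr rfl fun k _ => by ring
  rw [e] at key
  rw [key]
  refine sum_congr rfl fun k hk => ?_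
  obtain ⟨m, rfl⟩ : ∃ m, n = k + m := ⟨n - k, by rw [Finset.mem_range] at hk; omega⟩
  rw [Nat.add_sub_cancel_left]
  have hQ := norm_sq_lt_one hq
  have h1 := qPoch_ne_zero (self_mul_pow_ne_one hQ) m
  have h2 := qPoch_ne_zero (self_mul_pow_ne_one hQ) (m + 2 * k + 1)
  have h3 := one_add_pow_ne_zero hq (2 * k + 1)
  have h4 := pow_ne_zero (k * (k + 1)) hq0
  have h5 : ((-1 : ℂ) ^ k) * (-1) ^ k = 1 := by rw [← mul_pow]; simp
  have h6 : (-1 : ℂ) ^ k ≠ 0 := by simp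
  have h7 := one_sub_pow_ne_zero hQ (show 2 * k + 1 ≠ 0 by omega)
  rw [prod_erase_nodeFactor_odd_pow hq0 hq, odd_pow_eq]
  unfold omegaCoeff
  rw [inv_div, ← div_eq_mul_inv, div_div, div_div, div_eq_div_iff (by positivity) (by positivity)]
  linear_combination (-q ^ (k * (k + 1)) * (1 - (q ^ 2) ^ (2 * k + 1)) * qPoch (q ^ 2) (q ^ 2) m *
    qPoch (q ^ 2) (q ^ 2) (m + 2 * k + 1) * (1 + q ^ (2 * k + 1)) ^ 2) * h5

/-- Watson's expansion of `f(q)`. -/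
theorem qPochInf_mul_mockF (hq0 : q ≠ 0) (hq : ‖q‖ < 1) :
    qPochInf q q * mockF q = ∑' k : ℕ, fCoeff q k * q ^ k ^ 2 := by
  have h := tsum_bailey hq 0 (norm_fCoeff_le hq)
  have hinf := qPochInf_ne_zero hq (self_mul_pow_ne_one hq)
  simp only [add_zero, ← inv_qPoch_neg_sq hq0 hq, ← sq] at h
  rw [mockF]
  simp only [fTerm, div_eq_mul_inv]
  rw [h, mul_inv_cancel_left₀ hinf]

/-- Watson's expansion of `ω(-q)`. -/
theorem qPochInf_mul_mockOmega (hq0 : q ≠ 0) (hq : ‖q‖ < 1) :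
    qPochInf (q ^ 2) (q ^ 2) * mockOmega (-q) =
      ∑' k : ℕ, omegaCoeff q k * (q ^ 2) ^ (k * (k + 1)) := by
  have hQ := norm_sq_lt_one hq
  have h := tsum_bailey hQ 1 (norm_omegaCoeff_le hq)
  have hinf := qPochInf_ne_zero hQ (self_mul_pow_ne_one hQ)
  simp only [← inv_qPoch_neg_odd_sq hq0 hq] at h
  have e : ∀ n, omegaTerm (-q) n = (q ^ 2) ^ (n * (n + 1)) *
      (qPoch (-q) (q ^ 2) (n + 1) ^ 2)⁻¹ := by
    intro n
    rw [omegaTerm, neg_sq, mul_assoc, pow_mul, neg_sq, div_eq_mul_inv]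
  rw [mockOmega, tsum_congr e, h, mul_inv_cancel_left₀ hinf]

end Watson

/-! ### Logarithmic derivatives at the double poles -/

section LogDerivatives

open Finset

variable {Q q : ℂ}

/-- The sum of `1 / (1 - c Q ^ i)` over `M ≤ i < M + 2 n`. -/
noncomputable def tailSum (c Q : ℂ) (M n : ℕ) : ℂ :=
  ∑ i ∈ range (2 * n), 1 / (1 - c * Q ^ (M + i))

theorem sum_range_add_tailSum (c Q : ℂ) (M n : ℕ) :
    ∑ i ∈ range (M + 2 * n), 1 / (1 - c * Q ^ i) =
      (∑ i ∈ range M, 1 / (1 - c * Q ^ i)) + tailSum c Q M n :=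
  sum_range_add _ _ _

/-- Reversing the sum and using `1 / (1 - 1/z) = 1 - 1 / (1 - z)` with `z = d * Q^j`. This is where
the terms linear in `n` originate. -/
theorem sum_one_div_one_sub_div (hQ : Q ≠ 0) {c d : ℂ} (hcd : c * d = Q)
    (h : ∀ i, 1 - d * Q ^ i ≠ 0) (n : ℕ) :
    ∑ k ∈ range n, 1 / (1 - c * Q ^ k / Q ^ n) = n - ∑ i ∈ range n, 1 / (1 - d * Q ^ i) := by
  have e : (n : ℂ) = ∑ i ∈ range n, (1 : ℂ) := by simp
  rw [← sum_range_reflect, e, ← sum_sub_distrib]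
  refine sum_congr rfl fun j hj => ?_
  rw [mem_range] at hj
  have h1 : c * Q ^ (n - 1 - j) / Q ^ n = 1 / (d * Q ^ j) := by
    have hd : d ≠ 0 := by rintro rfl; exact hQ (by rw [← hcd, mul_zero])
    rw [div_eq_div_iff (pow_ne_zero _ hQ) (mul_ne_zero hd (pow_ne_zero _ hQ)), one_mul,
      show n = (n - 1 - j) + j + 1 by omega, pow_succ, pow_add]
    rw [show n - 1 - j + j + 1 - 1 - j = n - 1 - j by omega]
    linear_combination Q ^ (n - 1 - j) * Q ^ j * hcd
  rw [h1]
  have hz : d * Q ^ j ≠ 0 := by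
    have hd : d ≠ 0 := by rintro rfl; exact hQ (by rw [← hcd, mul_zero])
    exact mul_ne_zero hd (pow_ne_zero _ hQ)
  have h2 := h j
  have h3 : d * Q ^ j - 1 ≠ 0 := by rw [← neg_sub]; exact neg_ne_zero.2 h2
  rw [one_sub_div hz]
  field_simp
  ring

theorem pow_add_pow_ne_zero (hq0 : q ≠ 0) (hq : ‖q‖ < 1) (i k : ℕ) : q ^ i + q ^ k ≠ 0 := by
  intro e
  have hpos : 0 < ‖q‖ := norm_pos_iff.2 hq0
  have h1 : q ^ i = -q ^ k := by linear_combination e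
  have h2 := congrArg norm h1
  rw [norm_neg, norm_pow, norm_pow] at h2
  obtain rfl := pow_right_injective₀ hpos hq.ne h2
  have := pow_ne_zero i hq0
  apply this
  linear_combination e / 2

theorem nodeFactor_neg_pow_ne_zero (hq0 : q ≠ 0) (hq : ‖q‖ < 1) (i k : ℕ) :
    nodeFactor (-q ^ k) (q ^ i + (q ^ i)⁻¹) ≠ 0 := by
  have hi := pow_ne_zero i hq0
  rw [nodeFactor_node _ hi, neg_mul, ← pow_add, sub_neg_eq_add]
  refine mul_ne_zero (one_add_pow_ne_zero hq _) ?_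
  rw [one_sub_div hi, sub_neg_eq_add]
  exact div_ne_zero (pow_add_pow_ne_zero hq0 hq _ _) hi

/-- After `div_nodeFactor_node` the two sums overlap. What remains is the `n` from the reflection,
two boundary terms at exponents `n` and `2n`, and the `2n` terms collected in `tailSum`. -/
theorem sum_erase_div_nodeFactor (hQ : Q ≠ 0) (hQ1 : ‖Q‖ < 1) {n : ℕ} (hn : n ≠ 0) (M : ℕ) :
    ∑ k ∈ (range (n + M + 1)).erase n, Q ^ k / nodeFactor (Q ^ k) (Q ^ n + (Q ^ n)⁻¹) =
      Q ^ n / (1 - (Q ^ n) ^ 2) *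
        (n - 1 / (1 - Q ^ n) + 1 / (1 - (Q ^ n) ^ 2) - tailSum Q Q M n) := by
  have hn' := pow_ne_zero n hQ
  have h2 : 1 - (Q ^ n) ^ 2 ≠ 0 := by
    rw [← pow_mul]; exact one_sub_pow_ne_zero hQ1 (by omega)
  have e1 : ∀ k ∈ (range (n + M + 1)).erase n, Q ^ k / nodeFactor (Q ^ k) (Q ^ n + (Q ^ n)⁻¹) =
      Q ^ n / (1 - (Q ^ n) ^ 2) * (1 / (1 - Q ^ k / Q ^ n) - 1 / (1 - Q ^ k * Q ^ n)) := by
    intro k hk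
    have := nodeFactor_pow_ne_zero hQ hQ1 (ne_of_mem_erase hk)
    rw [nodeFactor_node _ hn'] at this
    exact div_nodeFactor_node hn' h2 (left_ne_zero_of_mul this) (right_ne_zero_of_mul this)
  rw [sum_congr rfl e1, ← mul_sum, sum_sub_distrib, sum_erase_range, sum_erase_range]
  congr 1
  have p1 := sum_one_div_one_sub_div hQ (one_mul Q)
    (fun i => sub_ne_zero.2 (self_mul_pow_ne_one hQ1 i).symm) n
  simp only [one_mul] at p1
  have p2 : ∑ m ∈ range M, 1 / (1 - Q ^ (n + 1 + m) / Q ^ n) =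
      ∑ i ∈ range M, 1 / (1 - Q * Q ^ i) :=
    sum_congr rfl fun m _ => by rw [pow_add, pow_add]; field_simp
  have p3 := sum_range_add_tailSum Q Q M n
  obtain ⟨l, rfl⟩ : ∃ l, n = l + 1 := ⟨n - 1, by omega⟩
  rw [show M + 2 * (l + 1) = l + (l + 1) + 1 + M by ring, sum_range_add,
    sum_range_succ _ (l + (l + 1)), sum_range_add] at p3
  have t1 : ∑ k ∈ range (l + 1), 1 / (1 - Q ^ k * Q ^ (l + 1)) =
      ∑ k ∈ range (l + 1), 1 / (1 - Q * Q ^ (l + k)) :=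
    sum_congr rfl fun k _ => by congr 2; ring
  have t2 : ∑ m ∈ range M, 1 / (1 - Q ^ (l + 1 + 1 + m) * Q ^ (l + 1)) =
      ∑ m ∈ range M, 1 / (1 - Q * Q ^ (l + (l + 1) + 1 + m)) :=
    sum_congr rfl fun k _ => by congr 2; ring
  have t3 : 1 / (1 - Q * Q ^ (l + (l + 1))) = 1 / (1 - (Q ^ (l + 1)) ^ 2) := by congr 2; ring
  have t4 : 1 / (1 - Q * Q ^ l) = 1 / (1 - Q ^ (l + 1)) := by congr 2; ring
  rw [t3] at p3
  rw [sum_range_succ (fun i => 1 / (1 - Q * Q ^ i)) l, t4] at p1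
  rw [p1, p2, t1, t2]
  linear_combination -p3

theorem sum_div_nodeFactor_neg (hQ : Q ≠ 0) (hQ1 : ‖Q‖ < 1) {n : ℕ} (hn : n ≠ 0) (M : ℕ) :
    ∑ k ∈ range (n + M + 1), -Q ^ k / nodeFactor (-Q ^ k) (Q ^ n + (Q ^ n)⁻¹) =
      Q ^ n / (1 - (Q ^ n) ^ 2) *
        (n - 1 / (1 + Q ^ n) + 1 / 2 - tailSum (-Q) Q M n) := by
  have hn' := pow_ne_zero n hQ
  have h2 : 1 - (Q ^ n) ^ 2 ≠ 0 := by
    rw [← pow_mul]; exact one_sub_pow_ne_zero hQ1 (by omega)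
  have e1 : ∀ k ∈ range (n + M + 1), -Q ^ k / nodeFactor (-Q ^ k) (Q ^ n + (Q ^ n)⁻¹) =
      Q ^ n / (1 - (Q ^ n) ^ 2) * (1 / (1 - -Q ^ k / Q ^ n) - 1 / (1 - -Q ^ k * Q ^ n)) := by
    intro k hk
    have := nodeFactor_neg_pow_ne_zero hQ hQ1 n k
    rw [nodeFactor_node _ hn'] at this
    exact div_nodeFactor_node hn' h2 (left_ne_zero_of_mul this) (right_ne_zero_of_mul this)
  rw [sum_congr rfl e1, ← mul_sum, sum_sub_distrib]
  congr 1
  have p1 := sum_one_div_one_sub_div hQ (c := -1) (d := -Q) (by ring)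
    (fun i => sub_ne_zero.2 (neg_self_mul_pow_ne_one hQ1 i).symm) n
  simp only [neg_one_mul] at p1
  have p2 : ∑ m ∈ range M, 1 / (1 - -Q ^ (n + (m + 1)) / Q ^ n) =
      ∑ i ∈ range M, 1 / (1 - -Q * Q ^ i) :=
    sum_congr rfl fun m _ => by
      congr 2
      rw [pow_add]; field_simp; ring
  have p3 := sum_range_add_tailSum (-Q) Q M n
  -- The `1 / 2` is the term `k = n`.
  have p4 : ∑ k ∈ range (n + M + 1), 1 / (1 - -Q ^ k / Q ^ n) =
      ((n : ℂ) - ∑ i ∈ range n, 1 / (1 - -Q * Q ^ i)) + ∑ i ∈ range M, 1 / (1 - -Q * Q ^ i) + 1 / 2 := by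
    rw [show n + M + 1 = n + (M + 1) by ring, sum_range_add, sum_range_succ' _ M, p1, p2,
      add_zero, neg_div, div_self hn']
    norm_num; ring
  obtain ⟨l, rfl⟩ : ∃ l, n = l + 1 := ⟨n - 1, by omega⟩
  rw [show M + 2 * (l + 1) = l + (l + 1 + M + 1) by ring, sum_range_add] at p3
  have t1 : ∑ k ∈ range (l + 1 + M + 1), 1 / (1 - -Q ^ k * Q ^ (l + 1)) =
      ∑ k ∈ range (l + 1 + M + 1), 1 / (1 - -Q * Q ^ (l + k)) :=
    sum_congr rfl fun k _ => by congr 2; ring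
  have t4 : 1 / (1 - -Q * Q ^ l) = 1 / (1 + Q ^ (l + 1)) := by congr 1; ring
  rw [p4, t1, sum_range_succ _ l, t4]
  linear_combination -p3

theorem sum_div_nodeFactor_neg_odd (hq0 : q ≠ 0) (hq : ‖q‖ < 1) {n : ℕ} (hn : n ≠ 0) (M : ℕ) :
    ∑ k ∈ range (n + M + 1), -(q * (q ^ 2) ^ k) /
        nodeFactor (-(q * (q ^ 2) ^ k)) ((q ^ 2) ^ n + ((q ^ 2) ^ n)⁻¹) =
      (q ^ 2) ^ n / (1 - ((q ^ 2) ^ n) ^ 2) * (n - tailSum (-q) (q ^ 2) (M + 1) n) := by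
  have hQ : q ^ 2 ≠ 0 := pow_ne_zero 2 hq0
  have hn' := pow_ne_zero n hQ
  have h2 : 1 - ((q ^ 2) ^ n) ^ 2 ≠ 0 := by
    rw [← pow_mul]; exact one_sub_pow_ne_zero (norm_sq_lt_one hq) (by omega)
  have e1 : ∀ k ∈ range (n + M + 1), -(q * (q ^ 2) ^ k) /
      nodeFactor (-(q * (q ^ 2) ^ k)) ((q ^ 2) ^ n + ((q ^ 2) ^ n)⁻¹) =
      (q ^ 2) ^ n / (1 - ((q ^ 2) ^ n) ^ 2) * (1 / (1 - -(q * (q ^ 2) ^ k) / (q ^ 2) ^ n) -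
        1 / (1 - -(q * (q ^ 2) ^ k) * (q ^ 2) ^ n)) := by
    intro k hk
    have := nodeFactor_neg_pow_ne_zero hq0 hq (2 * n) (2 * k + 1)
    rw [← odd_pow_eq, pow_mul, nodeFactor_node _ hn'] at this
    exact div_nodeFactor_node hn' h2 (left_ne_zero_of_mul this) (right_ne_zero_of_mul this)
  rw [sum_congr rfl e1, ← mul_sum, sum_sub_distrib]
  congr 1
  have p1 := sum_one_div_one_sub_div hQ (c := -q) (d := -q) (by ring)
    (fun i => sub_ne_zero.2 (neg_mul_sq_pow_ne_one hq i).symm) n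
  have p2 : ∑ m ∈ range (M + 1), 1 / (1 - -q * (q ^ 2) ^ (n + m) / (q ^ 2) ^ n) =
      ∑ i ∈ range (M + 1), 1 / (1 - -q * (q ^ 2) ^ i) :=
    sum_congr rfl fun m _ => by
      congr 2
      rw [pow_add]; field_simp
  have p3 := sum_range_add_tailSum (-q) (q ^ 2) (M + 1) n
  have p4 : ∑ k ∈ range (n + M + 1), 1 / (1 - -q * (q ^ 2) ^ k / (q ^ 2) ^ n) =
      ((n : ℂ) - ∑ i ∈ range n, 1 / (1 - -q * (q ^ 2) ^ i)) +
        ∑ i ∈ range (M + 1), 1 / (1 - -q * (q ^ 2) ^ i) := by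
    rw [show n + M + 1 = n + (M + 1) by ring, sum_range_add, p1, p2]
  rw [show M + 1 + 2 * n = n + (n + M + 1) by ring, sum_range_add] at p3
  have t1 : ∑ k ∈ range (n + M + 1), 1 / (1 - -q * (q ^ 2) ^ k * (q ^ 2) ^ n) =
      ∑ k ∈ range (n + M + 1), 1 / (1 - -q * (q ^ 2) ^ (n + k)) :=
    sum_congr rfl fun k _ => by congr 2; ring
  simp only [neg_mul] at p3 p4 t1 ⊢
  rw [p4, t1]
  linear_combination -p3

end LogDerivatives

/-! ### The finite identities -/

section FiniteIdentities

open Finset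

variable {q : ℂ}

/-- The residue at the double pole `q ^ n + q ^ (-n)` in the finite identity for `f`. -/
noncomputable def fDouble (q : ℂ) (n M : ℕ) : ℂ :=
  q ^ (n ^ 2 + tri n) / (2 * (1 - q ^ n)) *
    (3 * n + 1 / 2 - 1 / (1 - q ^ n) - 2 * tailSum q q M n - tailSum (-q) q M n) /
    ((qPoch q q M * qPoch q q (M + 2 * n)) ^ 2 * (qPoch (-q) q M * qPoch (-q) q (M + 2 * n)))

/-- The residue at the simple pole `-(q ^ j + q ^ (-j))` in the finite identity for `f`. -/
noncomputable def fSimple (q : ℂ) (j M : ℕ) : ℂ :=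
  fCoeff q j * q ^ j ^ 2 / (16 * ((qPoch (-q) q M * qPoch (-q) q (M + 2 * j)) ^ 2 *
    (qPoch q q M * qPoch q q (M + 2 * j))))

theorem prod_nodeFactor_neg_pow_one (q : ℂ) (N : ℕ) :
    ∏ j ∈ range (N + 1), nodeFactor (-q ^ j) (q ^ 0 + (q ^ 0)⁻¹) = 4 * qPoch (-q) q N ^ 2 := by
  rw [prod_range_succ', qPoch, ← prod_pow]
  have : ∏ k ∈ range N, nodeFactor (-q ^ (k + 1)) (q ^ 0 + (q ^ 0)⁻¹) =
      ∏ k ∈ range N, (1 - -q * q ^ k) ^ 2 :=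
    prod_congr rfl fun k _ => by rw [nodeFactor, pow_zero, inv_one]; ring
  rw [this, nodeFactor, pow_zero, inv_one]
  ring

theorem sum_erase_zero_div_nodeFactor (Q : ℂ) (N : ℕ) :
    ∑ k ∈ (range (N + 1)).erase 0, Q ^ k / nodeFactor (Q ^ k) (Q ^ 0 + (Q ^ 0)⁻¹) =
      ∑ k ∈ range N, Q ^ (k + 1) / (1 - Q ^ (k + 1)) ^ 2 := by
  have := sum_erase_range (fun k => Q ^ k / nodeFactor (Q ^ k) (Q ^ 0 + (Q ^ 0)⁻¹)) 0 N
  rw [zero_add] at this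
  rw [this, range_zero, sum_empty, zero_add]
  refine sum_congr rfl fun k _ => ?_
  rw [nodeFactor, pow_zero, inv_one, show 0 + 1 + k = k + 1 by ring]
  congr 1
  ring

theorem f_finite_identity (hq0 : q ≠ 0) (hq : ‖q‖ < 1) (N : ℕ) :
    (2 * ∑ k ∈ range N, q ^ (k + 1) / (1 - q ^ (k + 1)) ^ 2 -
        ∑ k ∈ range N, q ^ (k + 1) / (1 + q ^ (k + 1)) ^ 2 - 1 / 4) /
        (4 * (qPoch q q N ^ 4 * qPoch (-q) q N ^ 2)) +
      ∑ n ∈ range N, fDouble q (n + 1) (N - (n + 1)) +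
      ∑ j ∈ range (N + 1), fSimple q j (N - j) = 0 := by
  have key := sum_residues_nodeFactor_eq_zero (s := range (N + 1)) (t := range (N + 1))
    (p := fun k => q ^ k) (σ := fun k => -q ^ k) (by simp) (fun i _ => pow_ne_zero i hq0)
    (fun i _ => neg_ne_zero.2 (pow_ne_zero i hq0))
    (fun i _ k _ hk => nodeFactor_pow_ne_zero hq0 hq hk)
    (fun i _ k _ hk => by
      rw [nodeFactor_neg_node, neg_neg]; exact nodeFactor_pow_ne_zero hq0 hq hk)
    (fun i _ j _ => nodeFactor_neg_pow_ne_zero hq0 hq i j)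
  rw [sum_range_succ', sub_eq_add_neg, ← sum_neg_distrib] at key
  rw [← key, add_comm (_ / _)]
  congr 1
  · congr 1
    · refine sum_congr rfl fun l hl => ?_
      obtain ⟨M, rfl⟩ : ∃ M, N = l + 1 + M := ⟨N - (l + 1), by rw [mem_range] at hl; omega⟩
      rw [Nat.add_sub_cancel_left]
      set n := l + 1 with hn
      have hn0 : n ≠ 0 := by omega
      have h1 := qPoch_ne_zero (self_mul_pow_ne_one hq)
      have h2 := qPoch_ne_zero (neg_self_mul_pow_ne_one hq)
      rw [prod_erase_nodeFactor_pow hq0 hq hn0, prod_nodeFactor_neg_pow hq0 hq,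
        sum_erase_div_nodeFactor hq0 hq hn0, sum_div_nodeFactor_neg hq0 hq hn0, fDouble]
      have h3 := one_add_pow_ne_zero hq n
      have h4 := one_sub_pow_ne_zero hq hn0
      have h5 := pow_ne_zero n hq0
      have h6 := pow_ne_zero (tri n) hq0
      have h7 : 1 - (q ^ n) ^ 2 ≠ 0 := by
        rw [← pow_mul]; exact one_sub_pow_ne_zero hq (by omega)
      -- The three node products contribute `q^(3 tri n)`, the prefactor `q^(-2n)` and the
      -- logarithmic derivative `q^n`; the net exponent is `n² + tri n`, since `2 tri n = n² + n`.
      have h8 : q ^ (n ^ 2 + tri n) * q ^ n = (q ^ tri n) ^ 3 := by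
        rw [← pow_mul, ← pow_add]
        congr 1
        have := two_mul_tri n
        linarith
      have h9 : ((-1 : ℂ) ^ n) ^ 2 = 1 := by rw [← pow_mul, mul_comm, pow_mul]; simp
      have eB : (3 * n + 1 / 2 - 1 / (1 - q ^ n) - 2 * tailSum q q M n - tailSum (-q) q M n) =
          2 * (n - 1 / (1 - q ^ n) + 1 / (1 - (q ^ n) ^ 2) - tailSum q q M n) +
          (n - 1 / (1 + q ^ n) + 1 / 2 - tailSum (-q) q M n) := by
        have : 1 / (1 - (q ^ n) ^ 2) = 1 / (1 - q ^ n) * (1 / (1 + q ^ n)) := by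
          rw [one_div_mul_one_div]; congr 1; ring
        rw [this]
        field_simp
        ring
      rw [eB]
      generalize n - 1 / (1 - q ^ n) + 1 / (1 - (q ^ n) ^ 2) - tailSum q q M n = B1
      generalize n - 1 / (1 + q ^ n) + 1 / 2 - tailSum (-q) q M n = B2
      rw [mul_pow, div_pow, mul_pow, h9, show q ^ (n ^ 2 + tri n) = (q ^ tri n) ^ 3 / q ^ n by
        rw [← h8]; field_simp]
      rw [show 1 - (q ^ n) ^ 2 = (1 - q ^ n) * (1 + q ^ n) by ring]
      have a1 := h1 M
      have a2 := h1 (M + 2 * n)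
      have a3 := h2 M
      have a4 := h2 (M + 2 * n)
      field_simp
    · rw [prod_erase_zero_nodeFactor_pow, prod_nodeFactor_neg_pow_one,
        sum_erase_zero_div_nodeFactor, sum_range_succ']
      have : ∑ k ∈ range N, -q ^ (k + 1) / nodeFactor (-q ^ (k + 1)) (q ^ 0 + (q ^ 0)⁻¹) =
          -∑ k ∈ range N, q ^ (k + 1) / (1 + q ^ (k + 1)) ^ 2 := by
        rw [← sum_neg_distrib]
        refine sum_congr rfl fun k _ => ?_
        rw [nodeFactor, pow_zero, inv_one, neg_div]
        congr 2
        ring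
      -- The constant `-1/4` is the contribution of the simple pole `y = -2` to the logarithmic
      -- derivative at `y = 2`.
      rw [this, nodeFactor, pow_zero, inv_one, div_eq_inv_mul]
      congr 1
      · congr 1; ring
      · ring
  · refine sum_congr rfl fun j hj => ?_
    obtain ⟨M, rfl⟩ : ∃ M, N = j + M := ⟨N - j, by rw [mem_range] at hj; omega⟩
    rw [Nat.add_sub_cancel_left]
    simp only [nodeFactor_neg_node, neg_neg]
    rw [prod_nodeFactor_neg_pow hq0 hq, fSimple]
    have a1 := qPoch_ne_zero (self_mul_pow_ne_one hq) M
    have a2 := qPoch_ne_zero (self_mul_pow_ne_one hq) (M + 2 * j)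
    have a3 := qPoch_ne_zero (neg_self_mul_pow_ne_one hq) M
    have a4 := qPoch_ne_zero (neg_self_mul_pow_ne_one hq) (M + 2 * j)
    rcases eq_or_ne j 0 with rfl | hj0
    · rw [zero_add, prod_erase_zero_nodeFactor_pow]
      simp only [fCoeff, if_true, pow_zero, tri, mul_zero, add_zero, zero_mul, Nat.zero_div,
        zero_pow two_ne_zero]
      field_simp
      norm_num
    · rw [prod_erase_nodeFactor_pow hq0 hq hj0]
      simp only [fCoeff, if_neg hj0]
      have h3 := one_add_pow_ne_zero hq j
      have h5 := pow_ne_zero j hq0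
      have h6 := pow_ne_zero (tri j) hq0
      have h8 : q ^ j ^ 2 * q ^ j = (q ^ tri j) ^ 2 := by
        rw [← pow_mul, ← pow_add]
        congr 1
        have := two_mul_tri j
        linarith
      have h9 : ((-1 : ℂ) ^ j) ^ 2 = 1 := by rw [← pow_mul, mul_comm, pow_mul]; simp
      have h10 : (-1 : ℂ) ^ j ≠ 0 := by simp
      rw [show q ^ j ^ 2 = (q ^ tri j) ^ 2 / q ^ j by rw [← h8]; field_simp]
      field_simp
      rw [h9]
      norm_num

/-- The residue at the double pole `q ^ (2 n) + q ^ (-2 n)` in the finite identity for `ω`. -/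
noncomputable def omegaDouble (q : ℂ) (n M : ℕ) : ℂ :=
  q ^ (3 * n ^ 2) * (1 + (q ^ 2) ^ n) / (1 - (q ^ 2) ^ n) *
    (3 * n - 2 * (q ^ 2) ^ n / (1 - ((q ^ 2) ^ n) ^ 2) - 2 * tailSum (q ^ 2) (q ^ 2) M n -
      tailSum (-q) (q ^ 2) (M + 1) n) /
    ((qPoch (q ^ 2) (q ^ 2) M * qPoch (q ^ 2) (q ^ 2) (M + 2 * n)) ^ 2 *
      (qPoch (-q) (q ^ 2) (M + 1) * qPoch (-q) (q ^ 2) (M + 1 + 2 * n)))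

/-- The residue at the simple pole `-(q ^ (2 j + 1) + q ^ (-2 j - 1))` in the finite identity
for `ω`. -/
noncomputable def omegaSimple (q : ℂ) (j M : ℕ) : ℂ :=
  q * (omegaCoeff q j * (q ^ 2) ^ (j * (j + 1))) /
    ((qPoch (-q) (q ^ 2) M * qPoch (-q) (q ^ 2) (M + 2 * j + 1)) ^ 2 *
      (qPoch (q ^ 2) (q ^ 2) M * qPoch (q ^ 2) (q ^ 2) (M + 2 * j + 1)))

/-- Double poles come from the even powers `q^(2k)`, simple poles from `-q^(2k+1)`. Only the double
pole at `y = 2` is degenerate, so every simple pole follows one formula. -/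
theorem omega_finite_identity (hq0 : q ≠ 0) (hq : ‖q‖ < 1) (N : ℕ) :
    (2 * ∑ k ∈ range N, (q ^ 2) ^ (k + 1) / (1 - (q ^ 2) ^ (k + 1)) ^ 2 -
        ∑ k ∈ range (N + 1), q ^ (2 * k + 1) / (1 + q ^ (2 * k + 1)) ^ 2) /
        (qPoch (q ^ 2) (q ^ 2) N ^ 4 * qPoch (-q) (q ^ 2) (N + 1) ^ 2) +
      ∑ n ∈ range N, omegaDouble q (n + 1) (N - (n + 1)) +
      ∑ j ∈ range (N + 1), omegaSimple q j (N - j) = 0 := by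
  have hQ0 : q ^ 2 ≠ 0 := pow_ne_zero 2 hq0
  have hQ := norm_sq_lt_one hq
  have key := sum_residues_nodeFactor_eq_zero (s := range (N + 1)) (t := range (N + 1))
    (p := fun k => (q ^ 2) ^ k) (σ := fun k => -(q * (q ^ 2) ^ k)) (by simp)
    (fun i _ => pow_ne_zero i hQ0)
    (fun i _ => neg_ne_zero.2 (mul_ne_zero hq0 (pow_ne_zero i hQ0)))
    (fun i _ k _ hk => nodeFactor_pow_ne_zero hQ0 hQ hk)
    (fun i _ k _ hk => by
      rw [nodeFactor_neg_node, neg_neg, odd_pow_eq, odd_pow_eq]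
      exact nodeFactor_pow_ne_zero hq0 hq (by omega))
    (fun i _ j _ => by
      rw [odd_pow_eq, ← pow_mul]
      exact nodeFactor_neg_pow_ne_zero hq0 hq _ _)
  rw [sum_range_succ', sub_eq_add_neg, ← sum_neg_distrib] at key
  rw [← key, add_comm (_ / _)]
  congr 1
  · congr 1
    · refine sum_congr rfl fun l hl => ?_
      obtain ⟨M, rfl⟩ : ∃ M, N = l + 1 + M := ⟨N - (l + 1), by rw [mem_range] at hl; omega⟩
      rw [Nat.add_sub_cancel_left]
      set n := l + 1 with hn
      have hn0 : n ≠ 0 := by omega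
      rw [prod_erase_nodeFactor_pow hQ0 hQ hn0, prod_nodeFactor_neg_odd_pow hq0 hq,
        sum_erase_div_nodeFactor hQ0 hQ hn0, sum_div_nodeFactor_neg_odd hq0 hq hn0, omegaDouble,
        sq_pow_tri]
      have h3 := one_add_pow_ne_zero hQ n
      have h4 := one_sub_pow_ne_zero hQ hn0
      have h5 := pow_ne_zero n hQ0
      have h6 := pow_ne_zero (n * (n + 1)) hq0
      have h61 := pow_ne_zero (n ^ 2) hq0
      have h8 : q ^ (3 * n ^ 2) * (q ^ 2) ^ n = (q ^ (n * (n + 1))) ^ 2 * q ^ n ^ 2 := by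
        ring
      have h9 : ((-1 : ℂ) ^ n) ^ 2 = 1 := by rw [← pow_mul, mul_comm, pow_mul]; simp
      have eB : 3 * n - 2 * (q ^ 2) ^ n / (1 - ((q ^ 2) ^ n) ^ 2) -
          2 * tailSum (q ^ 2) (q ^ 2) M n - tailSum (-q) (q ^ 2) (M + 1) n =
          2 * (n - 1 / (1 - (q ^ 2) ^ n) + 1 / (1 - ((q ^ 2) ^ n) ^ 2) -
            tailSum (q ^ 2) (q ^ 2) M n) +
          (n - tailSum (-q) (q ^ 2) (M + 1) n) := by
        rw [show 1 - ((q ^ 2) ^ n) ^ 2 = (1 - (q ^ 2) ^ n) * (1 + (q ^ 2) ^ n) by ring]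
        generalize (q ^ 2) ^ n = x at *
        field_simp
        ring
      rw [eB]
      generalize n - 1 / (1 - (q ^ 2) ^ n) + 1 / (1 - ((q ^ 2) ^ n) ^ 2) -
            tailSum (q ^ 2) (q ^ 2) M n = B1
      generalize n - tailSum (-q) (q ^ 2) (M + 1) n = B2
      rw [div_pow, mul_pow, mul_pow, h9, show q ^ (3 * n ^ 2) =
        (q ^ (n * (n + 1))) ^ 2 * q ^ n ^ 2 / (q ^ 2) ^ n by rw [← h8, mul_div_cancel_right₀ _ h5]]
      rw [show 1 - ((q ^ 2) ^ n) ^ 2 = (1 - (q ^ 2) ^ n) * (1 + (q ^ 2) ^ n) by ring]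
      have a1 := qPoch_ne_zero (self_mul_pow_ne_one hQ) M
      have a2 := qPoch_ne_zero (self_mul_pow_ne_one hQ) (M + 2 * n)
      have a3 := qPoch_ne_zero (neg_mul_sq_pow_ne_one hq) (M + 1)
      have a4 := qPoch_ne_zero (neg_mul_sq_pow_ne_one hq) (M + 1 + 2 * n)
      generalize (q ^ 2) ^ n = x at *
      generalize q ^ (n * (n + 1)) = y at *
      generalize q ^ n ^ 2 = z at *
      field_simp
    · rw [prod_erase_zero_nodeFactor_pow, sum_erase_zero_div_nodeFactor]
      have e1 : ∏ j ∈ range (N + 1), nodeFactor (-(q * (q ^ 2) ^ j))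
          ((q ^ 2) ^ 0 + ((q ^ 2) ^ 0)⁻¹) = qPoch (-q) (q ^ 2) (N + 1) ^ 2 := by
        rw [qPoch, ← prod_pow]
        refine prod_congr rfl fun k _ => ?_
        rw [nodeFactor, pow_zero, inv_one]
        ring
      have e2 : ∑ k ∈ range (N + 1), -(q * (q ^ 2) ^ k) / nodeFactor (-(q * (q ^ 2) ^ k))
          ((q ^ 2) ^ 0 + ((q ^ 2) ^ 0)⁻¹) =
          -∑ k ∈ range (N + 1), q ^ (2 * k + 1) / (1 + q ^ (2 * k + 1)) ^ 2 := by
        rw [← sum_neg_distrib]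
        refine sum_congr rfl fun k _ => ?_
        rw [odd_pow_eq, nodeFactor, pow_zero, inv_one, neg_div]
        congr 2
        ring
      rw [e1, e2, pow_zero, div_eq_inv_mul]
      congr 1
      congr 1; ring
  · refine sum_congr rfl fun j hj => ?_
    obtain ⟨M, rfl⟩ : ∃ M, N = j + M := ⟨N - j, by rw [mem_range] at hj; omega⟩
    rw [Nat.add_sub_cancel_left, prod_nodeFactor_at_odd_pow hq0 hq]
    simp only [nodeFactor_neg_node, neg_neg]
    rw [prod_erase_nodeFactor_odd_pow hq0 hq, omegaSimple, omegaCoeff, odd_pow_eq]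
    have a1 := qPoch_ne_zero (self_mul_pow_ne_one hQ) M
    have a2 := qPoch_ne_zero (self_mul_pow_ne_one hQ) (M + 2 * j + 1)
    have a3 := qPoch_ne_zero (neg_mul_sq_pow_ne_one hq) M
    have a4 := qPoch_ne_zero (neg_mul_sq_pow_ne_one hq) (M + 2 * j + 1)
    have h3 := one_add_pow_ne_zero hq (2 * j + 1)
    have h4 := one_sub_pow_ne_zero hQ (show 2 * j + 1 ≠ 0 by omega)
    have h5 := pow_ne_zero (2 * j + 1) hq0
    have h6 := pow_ne_zero (j * (j + 1)) hq0
    have h61 := pow_ne_zero ((j + 1) ^ 2) hq0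
    have h8 : (q * (q ^ 2) ^ (j * (j + 1))) * q ^ (2 * j + 1) = (q ^ (j + 1) ^ 2) ^ 2 := by
      ring
    have h9 : ((-1 : ℂ) ^ j) ^ 2 = 1 := by rw [← pow_mul, mul_comm, pow_mul]; simp
    have h10 : (-1 : ℂ) ^ j ≠ 0 := by simp
    have h11 : q * ((-1) ^ j * q ^ (j * (j + 1)) * (1 - (q ^ 2) ^ (2 * j + 1)) /
        (1 + q ^ (2 * j + 1)) ^ 2 * (q ^ 2) ^ (j * (j + 1))) =
        (-1) ^ j * q ^ (j * (j + 1)) * (1 - (q ^ 2) ^ (2 * j + 1)) /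
        (1 + q ^ (2 * j + 1)) ^ 2 * ((q ^ (j + 1) ^ 2) ^ 2 / q ^ (2 * j + 1)) := by
      rw [← h8, mul_div_cancel_right₀ _ h5]
      ring
    rw [h11]
    generalize (q ^ 2) ^ (2 * j + 1) = w at *
    generalize q ^ (2 * j + 1) = x at *
    generalize q ^ (j * (j + 1)) = y at *
    generalize q ^ (j + 1) ^ 2 = z at *
    field_simp
    rw [h9]

end FiniteIdentities

/-! ### Passage to the limit -/

section Limits

variable {q Q c : ℂ}

/-- Tannery's theorem for the shape of the residue sums. The bound is uniform in `M`, so the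
truncated subtraction `N - n` is harmless for `n > N`. -/
theorem tendsto_sum_range_of_dominated {g : ℕ → ℕ → ℂ} {h : ℕ → ℂ} {bound : ℕ → ℝ}
    (hb : Summable bound) (hg : ∀ n M, ‖g n M‖ ≤ bound n)
    (hlim : ∀ n, Tendsto (g n) atTop (𝓝 (h n))) (s : ℕ) :
    Tendsto (fun N => ∑ n ∈ Finset.range (N + s), g n (N - n)) atTop (𝓝 (∑' n, h n)) := by
  have e : ∀ N, ∑ n ∈ Finset.range (N + s), g n (N - n) =
      ∑' n, if n ∈ Finset.range (N + s) then g n (N - n) else 0 := by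
    intro N
    rw [tsum_eq_sum (s := Finset.range (N + s)) (fun n hn => if_neg hn)]
    exact Finset.sum_congr rfl fun n hn => (if_pos hn).symm
  simp only [e]
  refine tendsto_tsum_of_dominated_convergence hb (fun n => ?_)
    (Eventually.of_forall fun N n => ?_)
  · refine ((hlim n).comp (tendsto_sub_atTop_nat n)).congr' ?_
    filter_upwards [eventually_gt_atTop n] with N hN
    rw [if_pos (Finset.mem_range.2 (by omega)), Function.comp]
  · split_ifs
    · exact hg _ _
    · rw [norm_zero]; exact (norm_nonneg _).trans (hg n 0)

theorem tendsto_one_div_one_sub_mul_pow (hQ : ‖Q‖ < 1) (c : ℂ) :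
    Tendsto (fun i => 1 / (1 - c * Q ^ i)) atTop (𝓝 1) := by
  have h := ((tendsto_pow_atTop_nhds_zero_of_norm_lt_one hQ).const_mul c).const_sub 1
  rw [mul_zero, sub_zero] at h
  simpa using h.inv₀ one_ne_zero

theorem tendsto_tailSum (hQ : ‖Q‖ < 1) (c : ℂ) (n : ℕ) :
    Tendsto (fun M => tailSum c Q M n) atTop (𝓝 (2 * n)) := by
  have h : Tendsto (fun M => tailSum c Q M n) atTop (𝓝 (∑ i ∈ Finset.range (2 * n), (1 : ℂ))) :=
    tendsto_finsetSum _ fun i _ =>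
      (tendsto_one_div_one_sub_mul_pow hQ c).comp (tendsto_add_atTop_nat i)
  simpa using h

theorem exists_norm_tailSum_le (hQ : ‖Q‖ < 1) (c : ℂ) :
    ∃ C : ℝ, 0 ≤ C ∧ ∀ M n, ‖tailSum c Q M n‖ ≤ 2 * n * C := by
  obtain ⟨C, hC⟩ := (Metric.isBounded_range_of_tendsto _
    (tendsto_one_div_one_sub_mul_pow hQ c)).exists_norm_le
  refine ⟨C, (norm_nonneg _).trans (hC _ ⟨0, rfl⟩), fun M n => ?_⟩
  refine (norm_sum_le_of_le _ (fun i _ => hC _ ⟨M + i, rfl⟩)).trans ?_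
  simp

theorem summable_linear_mul_geometric (hq : ‖q‖ < 1) :
    Summable fun n : ℕ => ((n : ℝ) + 1) * ‖q‖ ^ n := by
  have h1 := summable_pow_mul_geometric_of_norm_lt_one 1 (r := ‖q‖) (by simpa using hq)
  have h2 := summable_geometric_of_lt_one (norm_nonneg q) hq
  refine (h1.add h2).congr fun n => ?_
  rw [pow_one]; ring

theorem tendsto_qPoch_add (a : ℂ) (hq : ‖q‖ < 1) (k : ℕ) :
    Tendsto (fun M => qPoch a q (M + k)) atTop (𝓝 (qPochInf a q)) :=
  (tendsto_qPoch a hq).comp (tendsto_add_atTop_nat k)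

theorem summable_div_one_sub_sq (hq : ‖q‖ < 1) {e : ℕ → ℕ} (he : ∀ n, n < e n) :
    Summable fun n => q ^ e n / (1 - q ^ e n) ^ 2 := by
  refine Summable.of_norm_bounded ((summable_geometric_of_lt_one (norm_nonneg q) hq).mul_right
    ((1 - ‖q‖)⁻¹ ^ 2)) fun n => ?_
  rw [div_eq_mul_inv, norm_mul, ← inv_pow, norm_pow _ 2]
  have h1 := norm_inv_one_sub_le hq (norm_pow_le_self hq (show e n ≠ 0 by have := he n; omega))
  have h2 := norm_pow_le_of_le hq (he n).le
  gcongr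

theorem summable_div_one_add_sq (hq : ‖q‖ < 1) {e : ℕ → ℕ} (he : ∀ n, n < e n) :
    Summable fun n => q ^ e n / (1 + q ^ e n) ^ 2 := by
  refine Summable.of_norm_bounded ((summable_geometric_of_lt_one (norm_nonneg q) hq).mul_right
    ((1 - ‖q‖)⁻¹ ^ 2)) fun n => ?_
  rw [div_eq_mul_inv, norm_mul, ← inv_pow, norm_pow _ 2]
  have h1 := norm_inv_one_add_le hq (norm_pow_le_self hq (show e n ≠ 0 by have := he n; omega))
  have h2 := norm_pow_le_of_le hq (he n).le
  gcongr

theorem exists_norm_fDouble_le (hq : ‖q‖ < 1) :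
    ∃ K : ℝ, ∀ n M, n ≠ 0 → ‖fDouble q n M‖ ≤ K * (((n : ℝ) + 1) * ‖q‖ ^ n) := by
  obtain ⟨C₁, h₁, hC₁⟩ := exists_norm_inv_qPoch_le hq (self_mul_pow_ne_one hq)
  obtain ⟨C₂, h₂, hC₂⟩ := exists_norm_inv_qPoch_le hq (neg_self_mul_pow_ne_one hq)
  obtain ⟨T₁, t₁, hT₁⟩ := exists_norm_tailSum_le hq q
  obtain ⟨T₂, t₂, hT₂⟩ := exists_norm_tailSum_le hq (-q)
  set I := (1 - ‖q‖)⁻¹ with hI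
  have hI1 : 1 ≤ I := one_le_inv_one_sub_norm hq
  refine ⟨I * (4 + I + 4 * T₁ + 2 * T₂) * ((C₁ * C₁) ^ 2 * (C₂ * C₂)), fun n M hn => ?_⟩
  have e1 : ‖q ^ (n ^ 2 + tri n)‖ ≤ ‖q‖ ^ n := norm_pow_le_of_le hq (by nlinarith [Nat.pos_of_ne_zero hn])
  have e2 : ‖(1 - q ^ n)⁻¹‖ ≤ I := norm_inv_one_sub_le hq (norm_pow_le_self hq hn)
  have e3 : ‖3 * (n : ℂ) + 1 / 2 - 1 / (1 - q ^ n) - 2 * tailSum q q M n - tailSum (-q) q M n‖ ≤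
      (4 + I + 4 * T₁ + 2 * T₂) * ((n : ℝ) + 1) := by
    have a1 : ‖3 * (n : ℂ)‖ = 3 * n := by simp
    have a2 : ‖(1 / 2 : ℂ)‖ = 1 / 2 := by norm_num
    have a3 : ‖2 * tailSum q q M n‖ ≤ 2 * (2 * n * T₁) := by
      rw [norm_mul, Complex.norm_two]
      exact mul_le_mul_of_nonneg_left (hT₁ M n) (by norm_num)
    rw [← one_div] at e2
    calc _ ≤ ‖3 * (n : ℂ)‖ + ‖(1 / 2 : ℂ)‖ + ‖1 / (1 - q ^ n)‖ + ‖2 * tailSum q q M n‖ +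
          ‖tailSum (-q) q M n‖ := by
          refine (norm_sub_le _ _).trans ?_
          gcongr
          refine (norm_sub_le _ _).trans ?_
          gcongr
          refine (norm_sub_le _ _).trans ?_
          gcongr
          exact norm_add_le _ _
      _ ≤ 3 * n + 1 / 2 + I + 2 * (2 * n * T₁) + 2 * n * T₂ := by
          rw [a1, a2]
          gcongr
          exact hT₂ M n
      _ ≤ _ := by
          have hn0 : (0 : ℝ) ≤ n := Nat.cast_nonneg n
          nlinarith [mul_nonneg hn0 (zero_le_one.trans hI1)]
  have e4 : ‖(2 : ℂ)⁻¹‖ ≤ 1 := by norm_num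
  rw [fDouble, div_eq_mul_inv, div_eq_mul_inv]
  simp only [mul_inv, norm_mul, ← inv_pow, norm_pow _ 2]
  calc _ ≤ ‖q‖ ^ n * (1 * I) * ((4 + I + 4 * T₁ + 2 * T₂) * ((n : ℝ) + 1)) *
        ((C₁ * C₁) ^ 2 * (C₂ * C₂)) := by
        gcongr
        · exact hC₁ _
        · exact hC₁ _
        · exact hC₂ _
        · exact hC₂ _
    _ = _ := by ring

theorem exists_norm_fSimple_le (hq : ‖q‖ < 1) :
    ∃ K : ℝ, ∀ n M, ‖fSimple q n M‖ ≤ K * ‖q‖ ^ n := by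
  obtain ⟨C₁, h₁, hC₁⟩ := exists_norm_inv_qPoch_le hq (self_mul_pow_ne_one hq)
  obtain ⟨C₂, h₂, hC₂⟩ := exists_norm_inv_qPoch_le hq (neg_self_mul_pow_ne_one hq)
  have hI1 := one_le_inv_one_sub_norm hq
  refine ⟨4 * (1 - ‖q‖)⁻¹ * ((C₂ * C₂) ^ 2 * (C₁ * C₁)), fun n M => ?_⟩
  have e1 : ‖q ^ (n ^ 2)‖ ≤ ‖q‖ ^ n := norm_pow_le_of_le hq (by nlinarith)
  have e2 := norm_fCoeff_le hq n
  have e4 : ‖(16 : ℂ)⁻¹‖ ≤ 1 := by norm_num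
  rw [fSimple, div_eq_mul_inv]
  simp only [mul_inv, norm_mul, ← inv_pow, norm_pow _ 2]
  calc _ ≤ 4 * (1 - ‖q‖)⁻¹ * ‖q‖ ^ n * (1 * ((C₂ * C₂) ^ 2 * (C₁ * C₁))) := by
        gcongr
        · exact hC₂ _
        · exact hC₂ _
        · exact hC₁ _
        · exact hC₁ _
    _ = _ := by ring

/-- Termwise limit of `f_finite_identity`. Each `tailSum` tends to `2 n`, so the linear part becomes
`3 n - 2 * (2 n) - 2 n = -3 n`. -/
theorem f_lambert_identity (hq0 : q ≠ 0) (hq : ‖q‖ < 1) :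
    (2 * ∑' k : ℕ, q ^ (k + 1) / (1 - q ^ (k + 1)) ^ 2 -
        ∑' k : ℕ, q ^ (k + 1) / (1 + q ^ (k + 1)) ^ 2 - 1 / 4) /
        (4 * (qPochInf q q ^ 4 * qPochInf (-q) q ^ 2)) +
      (∑' n : ℕ, q ^ ((n + 1) ^ 2 + tri (n + 1)) / (2 * (1 - q ^ (n + 1))) *
        (1 / 2 - 1 / (1 - q ^ (n + 1)) - 3 * ((n + 1 : ℕ) : ℂ))) /
        (qPochInf q q ^ 4 * qPochInf (-q) q ^ 2) +
      (∑' j : ℕ, fCoeff q j * q ^ j ^ 2) / (16 * (qPochInf (-q) q ^ 4 * qPochInf q q ^ 2)) = 0 := by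
  have hP := qPochInf_ne_zero hq (self_mul_pow_ne_one hq)
  have hR := qPochInf_ne_zero hq (neg_self_mul_pow_ne_one hq)
  obtain ⟨K₁, hK₁⟩ := exists_norm_fDouble_le hq
  obtain ⟨K₂, hK₂⟩ := exists_norm_fSimple_le hq
  have L1 := ((((summable_div_one_sub_sq hq (fun n => n.lt_succ_self)).hasSum.tendsto_sum_nat.const_mul
    2).sub (summable_div_one_add_sq hq (fun n => n.lt_succ_self)).hasSum.tendsto_sum_nat).sub_const
    (1 / 4)).div ((((tendsto_qPoch q hq).pow 4).mul ((tendsto_qPoch (-q) hq).pow 2)).const_mul 4)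
    (mul_ne_zero (by norm_num) (mul_ne_zero (pow_ne_zero 4 hP) (pow_ne_zero 2 hR)))
  have L2 := tendsto_sum_range_of_dominated (g := fun n M => fDouble q (n + 1) M)
    (h := fun n => q ^ ((n + 1) ^ 2 + tri (n + 1)) / (2 * (1 - q ^ (n + 1))) *
        (1 / 2 - 1 / (1 - q ^ (n + 1)) - 3 * ((n + 1 : ℕ) : ℂ)) /
        (qPochInf q q ^ 4 * qPochInf (-q) q ^ 2))
    ((summable_nat_add_iff 1).2 ((summable_linear_mul_geometric hq).mul_left K₁))
    (fun n M => hK₁ (n + 1) M n.succ_ne_zero) (fun n => by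
      unfold fDouble
      have := (((tendsto_const_nhds (x := 3 * ((n + 1 : ℕ) : ℂ) + 1 / 2 -
        1 / (1 - q ^ (n + 1)))).sub ((tendsto_tailSum hq q (n + 1)).const_mul 2)).sub
        (tendsto_tailSum hq (-q) (n + 1)))
      have h2 := ((this.const_mul (q ^ ((n + 1) ^ 2 + tri (n + 1)) / (2 * (1 - q ^ (n + 1))))).div
        ((((tendsto_qPoch q hq).mul (tendsto_qPoch_add q hq (2 * (n + 1)))).pow 2).mul
          ((tendsto_qPoch (-q) hq).mul (tendsto_qPoch_add (-q) hq (2 * (n + 1)))))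
        (mul_ne_zero (pow_ne_zero 2 (mul_ne_zero hP hP)) (mul_ne_zero hR hR)))
      convert h2 using 2
      · rfl
      · congr 1 <;> ring) 1
  have L3 := tendsto_sum_range_of_dominated (g := fSimple q)
    (h := fun j => fCoeff q j * q ^ j ^ 2 / (16 * (qPochInf (-q) q ^ 4 * qPochInf q q ^ 2)))
    ((summable_geometric_of_lt_one (norm_nonneg q) hq).mul_left K₂)
    hK₂ (fun j => by
      unfold fSimple
      have h2 := (tendsto_const_nhds (x := fCoeff q j * q ^ j ^ 2)).div
        (((((tendsto_qPoch (-q) hq).mul (tendsto_qPoch_add (-q) hq (2 * j))).pow 2).mul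
          ((tendsto_qPoch q hq).mul (tendsto_qPoch_add q hq (2 * j)))).const_mul 16)
        (mul_ne_zero (by norm_num)
          (mul_ne_zero (pow_ne_zero 2 (mul_ne_zero hR hR)) (mul_ne_zero hP hP)))
      convert h2 using 2
      · rfl
      · congr 1
        ring) 1
  -- The double poles other than `y = 2` start at `n = 1`; their sum at level `N` is the shifted sum
  -- at level `N - 1`.
  have L2' := L2.comp (tendsto_sub_atTop_nat 1)
  have L := (L1.add L2').add L3
  rw [tsum_div_const, tsum_div_const] at L
  refine tendsto_nhds_unique (L.congr' ?_) tendsto_const_nhds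
  filter_upwards [eventually_ge_atTop 1] with N hN
  rw [← f_finite_identity hq0 hq N]
  obtain ⟨M, rfl⟩ : ∃ M, N = M + 1 := ⟨N - 1, by omega⟩
  simp only [Function.comp, Nat.add_sub_cancel, Nat.add_sub_add_right]
  rfl

theorem exists_norm_omegaDouble_le (hq : ‖q‖ < 1) :
    ∃ K : ℝ, ∀ n M, n ≠ 0 → ‖omegaDouble q n M‖ ≤ K * (((n : ℝ) + 1) * ‖q‖ ^ n) := by
  have hQ := norm_sq_lt_one hq
  obtain ⟨C₁, h₁, hC₁⟩ := exists_norm_inv_qPoch_le hQ (self_mul_pow_ne_one hQ)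
  obtain ⟨C₂, h₂, hC₂⟩ := exists_norm_inv_qPoch_le hQ (neg_mul_sq_pow_ne_one hq)
  obtain ⟨T₁, t₁, hT₁⟩ := exists_norm_tailSum_le hQ (q ^ 2)
  obtain ⟨T₂, t₂, hT₂⟩ := exists_norm_tailSum_le hQ (-q)
  set I := (1 - ‖q ^ 2‖)⁻¹ with hI
  have hI1 : 1 ≤ I := one_le_inv_one_sub_norm hQ
  refine ⟨2 * I * (4 + 2 * I + 4 * T₁ + 2 * T₂) * ((C₁ * C₁) ^ 2 * (C₂ * C₂)), fun n M hn => ?_⟩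
  have e1 : ‖q ^ (3 * n ^ 2)‖ ≤ ‖q‖ ^ n :=
    norm_pow_le_of_le hq (by nlinarith [Nat.pos_of_ne_zero hn])
  have e2 : ‖(1 - (q ^ 2) ^ n)⁻¹‖ ≤ I := norm_inv_one_sub_le hQ (norm_pow_le_self hQ hn)
  have e2' : ‖(1 - ((q ^ 2) ^ n) ^ 2)⁻¹‖ ≤ I := by
    rw [← pow_mul (q ^ 2)]
    exact norm_inv_one_sub_le hQ (norm_pow_le_self hQ (by omega))
  have e0 : ‖(q ^ 2) ^ n‖ ≤ 1 := norm_pow_le_one hQ n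
  have e0' : ‖1 + (q ^ 2) ^ n‖ ≤ 2 := (norm_add_le _ _).trans (by rw [norm_one]; linarith)
  have e3 : ‖3 * (n : ℂ) - 2 * (q ^ 2) ^ n / (1 - ((q ^ 2) ^ n) ^ 2) -
      2 * tailSum (q ^ 2) (q ^ 2) M n - tailSum (-q) (q ^ 2) (M + 1) n‖ ≤
      (4 + 2 * I + 4 * T₁ + 2 * T₂) * ((n : ℝ) + 1) := by
    have a1 : ‖3 * (n : ℂ)‖ = 3 * n := by simp
    have a2 : ‖2 * (q ^ 2) ^ n / (1 - ((q ^ 2) ^ n) ^ 2)‖ ≤ 2 * 1 * I := by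
      rw [div_eq_mul_inv, norm_mul, norm_mul, Complex.norm_two]
      gcongr
    have a3 : ‖2 * tailSum (q ^ 2) (q ^ 2) M n‖ ≤ 2 * (2 * n * T₁) := by
      rw [norm_mul, Complex.norm_two]
      exact mul_le_mul_of_nonneg_left (hT₁ M n) (by norm_num)
    calc _ ≤ ‖3 * (n : ℂ)‖ + ‖2 * (q ^ 2) ^ n / (1 - ((q ^ 2) ^ n) ^ 2)‖ +
          ‖2 * tailSum (q ^ 2) (q ^ 2) M n‖ + ‖tailSum (-q) (q ^ 2) (M + 1) n‖ := by
          refine (norm_sub_le _ _).trans ?_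
          gcongr
          refine (norm_sub_le _ _).trans ?_
          gcongr
          exact norm_sub_le _ _
      _ ≤ 3 * n + 2 * 1 * I + 2 * (2 * n * T₁) + 2 * n * T₂ := by
          rw [a1]
          gcongr
          exact hT₂ _ n
      _ ≤ _ := by
          have hn0 : (0 : ℝ) ≤ n := Nat.cast_nonneg n
          nlinarith [mul_nonneg hn0 (zero_le_one.trans hI1)]
  rw [omegaDouble, div_eq_mul_inv, div_eq_mul_inv]
  simp only [mul_inv, norm_mul, ← inv_pow, norm_pow _ 2]
  calc _ ≤ ‖q‖ ^ n * 2 * I * ((4 + 2 * I + 4 * T₁ + 2 * T₂) * ((n : ℝ) + 1)) *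
        ((C₁ * C₁) ^ 2 * (C₂ * C₂)) := by
        gcongr
        · exact hC₁ _
        · exact hC₁ _
        · exact hC₂ _
        · exact hC₂ _
    _ = _ := by ring

theorem exists_norm_omegaSimple_le (hq : ‖q‖ < 1) :
    ∃ K : ℝ, ∀ n M, ‖omegaSimple q n M‖ ≤ K * ‖q‖ ^ n := by
  have hQ := norm_sq_lt_one hq
  obtain ⟨C₁, h₁, hC₁⟩ := exists_norm_inv_qPoch_le hQ (self_mul_pow_ne_one hQ)
  obtain ⟨C₂, h₂, hC₂⟩ := exists_norm_inv_qPoch_le hQ (neg_mul_sq_pow_ne_one hq)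
  have hI1 := one_le_inv_one_sub_norm hq
  refine ⟨2 * ((1 - ‖q‖)⁻¹ * (1 - ‖q‖)⁻¹) * ((C₂ * C₂) ^ 2 * (C₁ * C₁)), fun n M => ?_⟩
  have e1 : ‖(q ^ 2) ^ (n * (n + 1))‖ ≤ ‖q‖ ^ n := by
    rw [← pow_mul]
    exact norm_pow_le_of_le hq (by nlinarith [Nat.zero_le (n * n)])
  have e2 := norm_omegaCoeff_le hq n
  rw [omegaSimple, div_eq_mul_inv]
  simp only [mul_inv]
  rw [norm_mul, norm_mul, norm_mul, norm_mul, ← inv_pow, norm_pow _ 2]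
  simp only [mul_inv, norm_mul _ (qPoch _ _ _)⁻¹]
  calc _ ≤ 1 * (2 * ((1 - ‖q‖)⁻¹ * (1 - ‖q‖)⁻¹) * ‖q‖ ^ n) *
        ((C₂ * C₂) ^ 2 * (C₁ * C₁)) := by
        gcongr
        · exact hC₂ _
        · exact hC₂ _
        · exact hC₁ _
        · exact hC₁ _
    _ = _ := by ring

theorem omega_lambert_identity (hq0 : q ≠ 0) (hq : ‖q‖ < 1) :
    (2 * ∑' k : ℕ, (q ^ 2) ^ (k + 1) / (1 - (q ^ 2) ^ (k + 1)) ^ 2 -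
        ∑' k : ℕ, q ^ (2 * k + 1) / (1 + q ^ (2 * k + 1)) ^ 2) /
        (qPochInf (q ^ 2) (q ^ 2) ^ 4 * qPochInf (-q) (q ^ 2) ^ 2) +
      (∑' n : ℕ, q ^ (3 * (n + 1) ^ 2) * (1 + (q ^ 2) ^ (n + 1)) / (1 - (q ^ 2) ^ (n + 1)) *
        (-(2 * (q ^ 2) ^ (n + 1) / (1 - ((q ^ 2) ^ (n + 1)) ^ 2)) - 3 * ((n + 1 : ℕ) : ℂ))) /
        (qPochInf (q ^ 2) (q ^ 2) ^ 4 * qPochInf (-q) (q ^ 2) ^ 2) +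
      q * (∑' j : ℕ, omegaCoeff q j * (q ^ 2) ^ (j * (j + 1))) /
        (qPochInf (-q) (q ^ 2) ^ 4 * qPochInf (q ^ 2) (q ^ 2) ^ 2) = 0 := by
  have hQ := norm_sq_lt_one hq
  have hP := qPochInf_ne_zero hQ (self_mul_pow_ne_one hQ)
  have hR := qPochInf_ne_zero hQ (neg_mul_sq_pow_ne_one hq)
  obtain ⟨K₁, hK₁⟩ := exists_norm_omegaDouble_le hq
  obtain ⟨K₂, hK₂⟩ := exists_norm_omegaSimple_le hq
  have L1 := (((summable_div_one_sub_sq hQ (fun n => n.lt_succ_self)).hasSum.tendsto_sum_nat.const_mul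
    2).sub ((summable_div_one_add_sq hq (e := fun n => 2 * n + 1)
      (fun n => by omega)).hasSum.tendsto_sum_nat.comp (tendsto_add_atTop_nat 1))).div
    (((tendsto_qPoch (q ^ 2) hQ).pow 4).mul ((tendsto_qPoch_add (-q) hQ 1).pow 2))
    (mul_ne_zero (pow_ne_zero 4 hP) (pow_ne_zero 2 hR))
  have L2 := tendsto_sum_range_of_dominated (g := fun n M => omegaDouble q (n + 1) M)
    (h := fun n => q ^ (3 * (n + 1) ^ 2) * (1 + (q ^ 2) ^ (n + 1)) / (1 - (q ^ 2) ^ (n + 1)) *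
        (-(2 * (q ^ 2) ^ (n + 1) / (1 - ((q ^ 2) ^ (n + 1)) ^ 2)) - 3 * ((n + 1 : ℕ) : ℂ)) /
        (qPochInf (q ^ 2) (q ^ 2) ^ 4 * qPochInf (-q) (q ^ 2) ^ 2))
    ((summable_nat_add_iff 1).2 ((summable_linear_mul_geometric hq).mul_left K₁))
    (fun n M => hK₁ (n + 1) M n.succ_ne_zero) (fun n => by
      unfold omegaDouble
      have := (((tendsto_const_nhds (x := 3 * ((n + 1 : ℕ) : ℂ) -
        2 * (q ^ 2) ^ (n + 1) / (1 - ((q ^ 2) ^ (n + 1)) ^ 2))).sub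
        ((tendsto_tailSum hQ (q ^ 2) (n + 1)).const_mul 2)).sub
        ((tendsto_tailSum hQ (-q) (n + 1)).comp (tendsto_add_atTop_nat 1)))
      have h2 := ((this.const_mul
        (q ^ (3 * (n + 1) ^ 2) * (1 + (q ^ 2) ^ (n + 1)) / (1 - (q ^ 2) ^ (n + 1)))).div
        ((((tendsto_qPoch (q ^ 2) hQ).mul (tendsto_qPoch_add (q ^ 2) hQ (2 * (n + 1)))).pow 2).mul
          ((tendsto_qPoch_add (-q) hQ 1).mul
            ((tendsto_qPoch_add (-q) hQ (2 * (n + 1))).comp (tendsto_add_atTop_nat 1))))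
        (mul_ne_zero (pow_ne_zero 2 (mul_ne_zero hP hP)) (mul_ne_zero hR hR)))
      convert h2 using 2
      · rfl
      · congr 1 <;> ring) 1
  have L3 := tendsto_sum_range_of_dominated (g := omegaSimple q)
    (h := fun j => q * (omegaCoeff q j * (q ^ 2) ^ (j * (j + 1))) /
      (qPochInf (-q) (q ^ 2) ^ 4 * qPochInf (q ^ 2) (q ^ 2) ^ 2))
    ((summable_geometric_of_lt_one (norm_nonneg q) hq).mul_left K₂)
    hK₂ (fun j => by
      unfold omegaSimple
      have h2 := (tendsto_const_nhds (x := q * (omegaCoeff q j * (q ^ 2) ^ (j * (j + 1))))).div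
        ((((tendsto_qPoch (-q) hQ).mul (tendsto_qPoch_add (-q) hQ (2 * j + 1))).pow 2).mul
          ((tendsto_qPoch (q ^ 2) hQ).mul (tendsto_qPoch_add (q ^ 2) hQ (2 * j + 1))))
        (mul_ne_zero (pow_ne_zero 2 (mul_ne_zero hR hR)) (mul_ne_zero hP hP))
      convert h2 using 2
      · rfl
      · congr 1
        ring) 1
  have L2' := L2.comp (tendsto_sub_atTop_nat 1)
  have L := (L1.add L2').add L3
  rw [tsum_div_const, tsum_div_const, tsum_mul_left] at L
  refine tendsto_nhds_unique (L.congr' ?_) tendsto_const_nhds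
  filter_upwards [eventually_ge_atTop 1] with N hN
  rw [← omega_finite_identity hq0 hq N]
  obtain ⟨M, rfl⟩ : ∃ M, N = M + 1 := ⟨N - 1, by omega⟩
  simp only [Function.comp, Nat.add_sub_cancel, Nat.add_sub_add_right]
  rfl

end Limits

/-! ### Folding sums over nonzero integers -/

section IntegerSums

variable {q Q : ℂ}

theorem summable_and_tsum_int_ne_zero {f : ℤ → ℂ} {u v : ℕ → ℂ} (hu : Summable u)
    (hv : Summable v) (hfu : ∀ n : ℕ, f ((n : ℤ) + 1) = u n)
    (hfv : ∀ n : ℕ, f (-((n : ℤ) + 1)) = v n) :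
    Summable (fun n : {n : ℤ // n ≠ 0} => f n) ∧
      ∑' n : {n : ℤ // n ≠ 0}, f n = ∑' n, (u n + v n) := by
  set h : ℤ → ℂ := Set.indicator {n : ℤ | n ≠ 0} f with hh
  have h1 : ∀ n : ℕ, h ((n : ℤ) + 1) = u n := fun n => by
    rw [hh, Set.indicator_of_mem (by simp; omega), hfu]
  have h2 : ∀ n : ℕ, h (-((n : ℤ) + 1)) = v n := fun n => by
    rw [hh, Set.indicator_of_mem (by simp; omega), hfv]
  have h0 : h 0 = 0 := Set.indicator_of_notMem (by simp) _
  have key : HasSum h (∑' n, u n + h 0 + ∑' n, v n) :=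
    HasSum.of_add_one_of_neg_add_one (by simpa only [h1] using hu.hasSum)
      (by simpa only [h2] using hv.hasSum)
  rw [h0, add_zero, ← hu.tsum_add hv] at key
  have key2 : HasSum (fun n : {n : ℤ // n ≠ 0} => f n) (∑' n, (u n + v n)) :=
    hasSum_subtype_iff_indicator.2 key
  exact ⟨key2.summable, key2.tsum_eq⟩

theorem summable_mul_pow_mul (hq : ‖q‖ < 1) {a b : ℕ → ℂ} {e : ℕ → ℕ} {K L : ℝ}
    (ha : ∀ n, ‖a n‖ ≤ K * ((n : ℝ) + 1)) (he : ∀ n, n ≤ e n) (hb : ∀ n, ‖b n‖ ≤ L) :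
    Summable fun n => a n * q ^ e n * b n := by
  refine Summable.of_norm_bounded ((summable_linear_mul_geometric hq).mul_left (K * L))
    fun n => ?_
  have h2 := norm_pow_le_of_le hq (he n)
  have hK := (norm_nonneg _).trans (ha n)
  rw [norm_mul, norm_mul, show K * L * (((n : ℝ) + 1) * ‖q‖ ^ n) =
    K * ((n : ℝ) + 1) * ‖q‖ ^ n * L by ring]
  exact mul_le_mul (mul_le_mul (ha n) h2 (norm_nonneg _) hK) (hb n) (norm_nonneg _)
    (mul_nonneg hK (by positivity))

theorem norm_linear_le (a b : ℝ) (n : ℕ) :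
    ‖(a : ℂ) * ((n : ℂ) + 1) + b‖ ≤ (|a| + |b|) * ((n : ℝ) + 1) := by
  have h1 : ‖((n : ℂ) + 1)‖ = n + 1 := by
    have := Complex.norm_natCast (n + 1)
    push_cast at this
    exact this
  refine (norm_add_le _ _).trans ?_
  rw [norm_mul, h1, Complex.norm_real, Complex.norm_real, Real.norm_eq_abs, Real.norm_eq_abs]
  nlinarith [abs_nonneg b, mul_nonneg (abs_nonneg b) (Nat.cast_nonneg (α := ℝ) n)]

theorem summable_linear_mul_pow_div (hq : ‖q‖ < 1) (hQ : ‖Q‖ < 1) (a b : ℝ) {e : ℕ → ℕ}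
    (he : ∀ n, n ≤ e n) (k : ℕ) :
    Summable fun n : ℕ => ((a : ℂ) * ((n : ℂ) + 1) + b) * q ^ e n / (1 - Q ^ (n + 1)) ^ k := by
  have := summable_mul_pow_mul hq (norm_linear_le a b) he
    (b := fun n => ((1 - Q ^ (n + 1)) ^ k)⁻¹) (L := (1 - ‖Q‖)⁻¹ ^ k) (fun n => by
      rw [← inv_pow, norm_pow]
      exact pow_le_pow_left₀ (norm_nonneg _)
        (norm_inv_one_sub_le hQ (norm_pow_le_self hQ n.succ_ne_zero)) k)
  exact this.congr fun n => (div_eq_mul_inv _ _).symm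

theorem pentagonal_exponent (n : ℕ) :
    ((n : ℤ) + 1) * (3 * ((n : ℤ) + 1) + 1) / 2 = ((n + 1) ^ 2 + tri (n + 1) : ℕ) := by
  apply Int.ediv_eq_of_eq_mul_right two_ne_zero
  have := two_mul_tri (n + 1)
  zify at this
  push_cast
  linarith

theorem pentagonal_exponent_neg (n : ℕ) :
    -((n : ℤ) + 1) * (3 * -((n : ℤ) + 1) + 1) / 2 =
      ((n + 1) ^ 2 + tri (n + 1) : ℕ) - ((n + 1 : ℕ) : ℤ) := by
  apply Int.ediv_eq_of_eq_mul_right two_ne_zero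
  have := two_mul_tri (n + 1)
  zify at this
  push_cast
  linarith

theorem one_sub_zpow_neg (hQ : Q ≠ 0) (n : ℕ) :
    1 - Q ^ (-((n : ℤ) + 1)) = -(1 - Q ^ (n + 1)) / Q ^ (n + 1) := by
  have := pow_ne_zero (n + 1) hQ
  rw [zpow_neg, show Q ^ ((n : ℤ) + 1) = Q ^ (n + 1) by rw [← zpow_natCast]; norm_cast]
  field_simp
  ring

theorem zpow_natCast_add_one (Q : ℂ) (n : ℕ) : Q ^ ((n : ℤ) + 1) = Q ^ (n + 1) := by
  rw [← zpow_natCast]; norm_cast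

theorem f_first_int_sum (hq0 : q ≠ 0) (hq : ‖q‖ < 1) :
    Summable (fun n : {n : ℤ // n ≠ 0} =>
      q ^ ((n : ℤ) * (3 * (n : ℤ) + 1) / 2) / (1 - q ^ (n : ℤ)) ^ 2) ∧
    ∑' n : {n : ℤ // n ≠ 0}, q ^ ((n : ℤ) * (3 * (n : ℤ) + 1) / 2) / (1 - q ^ (n : ℤ)) ^ 2 =
      ∑' n : ℕ, (q ^ ((n + 1) ^ 2 + tri (n + 1)) / (1 - q ^ (n + 1)) ^ 2 +
        q ^ ((n + 1) ^ 2 + tri (n + 1) + (n + 1)) / (1 - q ^ (n + 1)) ^ 2) := by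
  refine summable_and_tsum_int_ne_zero
    (f := fun n : ℤ => q ^ (n * (3 * n + 1) / 2) / (1 - q ^ n) ^ 2)
    ((summable_linear_mul_pow_div hq hq 0 1 (e := fun n => (n + 1) ^ 2 + tri (n + 1))
      (fun n => by nlinarith) 2).congr fun n => by simp)
    ((summable_linear_mul_pow_div hq hq 0 1 (e := fun n => (n + 1) ^ 2 + tri (n + 1) + (n + 1))
      (fun n => by nlinarith) 2).congr fun n => by simp) (fun n => ?_) (fun n => ?_)
  · rw [pentagonal_exponent, zpow_natCast, zpow_natCast_add_one]
  -- With `m = n + 1`, the index `-m` lowers the exponent by `m`, while `(1 - q^(-m))^2 = (1 -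
  -- q^m)^2 / q^(2m)` raises it by `2m`: a net gain of `m`.
  · rw [pentagonal_exponent_neg, zpow_sub₀ hq0, zpow_natCast, zpow_natCast, one_sub_zpow_neg hq0]
    have h1 := pow_ne_zero (n + 1) hq0
    have h2 := one_sub_pow_ne_zero hq n.succ_ne_zero
    rw [Nat.succ_eq_add_one] at h2
    rw [pow_add _ _ (n + 1)]
    generalize q ^ (n + 1) = x at *
    field_simp

theorem f_second_int_sum (hq0 : q ≠ 0) (hq : ‖q‖ < 1) :
    Summable (fun n : {n : ℤ // n ≠ 0} =>
      (6 * ((n : ℤ) : ℂ) - 1) * q ^ ((n : ℤ) * (3 * (n : ℤ) + 1) / 2) / (1 - q ^ (n : ℤ))) ∧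
    ∑' n : {n : ℤ // n ≠ 0},
      (6 * ((n : ℤ) : ℂ) - 1) * q ^ ((n : ℤ) * (3 * (n : ℤ) + 1) / 2) / (1 - q ^ (n : ℤ)) =
      ∑' n : ℕ, ((6 * ((n : ℂ) + 1) - 1) * q ^ ((n + 1) ^ 2 + tri (n + 1)) / (1 - q ^ (n + 1)) +
        (6 * ((n : ℂ) + 1) + 1) * q ^ ((n + 1) ^ 2 + tri (n + 1)) / (1 - q ^ (n + 1))) := by
  refine summable_and_tsum_int_ne_zero
    (f := fun n : ℤ => (6 * (n : ℂ) - 1) * q ^ (n * (3 * n + 1) / 2) / (1 - q ^ n))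
    ((summable_linear_mul_pow_div hq hq 6 (-1) (e := fun n => (n + 1) ^ 2 + tri (n + 1))
      (fun n => by nlinarith) 1).congr fun n => by simp [sub_eq_add_neg])
    ((summable_linear_mul_pow_div hq hq 6 1 (e := fun n => (n + 1) ^ 2 + tri (n + 1))
      (fun n => by nlinarith) 1).congr fun n => by simp) (fun n => ?_) (fun n => ?_)
  · rw [pentagonal_exponent, zpow_natCast, zpow_natCast_add_one]
    push_cast
    rfl
  · rw [pentagonal_exponent_neg, zpow_sub₀ hq0, zpow_natCast, zpow_natCast, one_sub_zpow_neg hq0]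
    have h1 := pow_ne_zero (n + 1) hq0
    have h2 := one_sub_pow_ne_zero hq n.succ_ne_zero
    rw [Nat.succ_eq_add_one] at h2
    push_cast
    generalize q ^ (n + 1) = x at *
    field_simp
    ring

theorem three_mul_sq_exponent (n : ℕ) : 3 * ((n : ℤ) + 1) ^ 2 = (3 * (n + 1) ^ 2 : ℕ) := by
  push_cast; ring

theorem three_mul_neg_sq_exponent (n : ℕ) :
    3 * (-((n : ℤ) + 1)) ^ 2 = (3 * (n + 1) ^ 2 : ℕ) := by
  push_cast; ring

theorem omega_first_int_sum (hq0 : q ≠ 0) (hq : ‖q‖ < 1) :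
    Summable (fun n : {n : ℤ // n ≠ 0} =>
      q ^ (3 * (n : ℤ) ^ 2) / (1 - q ^ (2 * (n : ℤ))) ^ 2) ∧
    ∑' n : {n : ℤ // n ≠ 0}, q ^ (3 * (n : ℤ) ^ 2) / (1 - q ^ (2 * (n : ℤ))) ^ 2 =
      ∑' n : ℕ, (q ^ (3 * (n + 1) ^ 2) / (1 - (q ^ 2) ^ (n + 1)) ^ 2 +
        q ^ (3 * (n + 1) ^ 2 + 2 * (2 * (n + 1))) / (1 - (q ^ 2) ^ (n + 1)) ^ 2) := by
  have hQ := norm_sq_lt_one hq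
  refine summable_and_tsum_int_ne_zero
    (f := fun n : ℤ => q ^ (3 * n ^ 2) / (1 - q ^ (2 * n)) ^ 2)
    ((summable_linear_mul_pow_div hq hQ 0 1 (e := fun n => 3 * (n + 1) ^ 2)
      (fun n => by nlinarith) 2).congr fun n => by simp)
    ((summable_linear_mul_pow_div hq hQ 0 1 (e := fun n => 3 * (n + 1) ^ 2 + 2 * (2 * (n + 1)))
      (fun n => by nlinarith) 2).congr fun n => by simp) (fun n => ?_) (fun n => ?_)
  · rw [three_mul_sq_exponent, zpow_natCast, zpow_mul, zpow_ofNat, zpow_natCast_add_one]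
  · rw [three_mul_neg_sq_exponent, zpow_natCast, zpow_mul, zpow_ofNat,
      one_sub_zpow_neg (pow_ne_zero 2 hq0)]
    have h1 := pow_ne_zero (n + 1) (pow_ne_zero 2 hq0)
    have h2 := one_sub_pow_ne_zero hQ n.succ_ne_zero
    rw [Nat.succ_eq_add_one] at h2
    rw [show q ^ (3 * (n + 1) ^ 2 + 2 * (2 * (n + 1))) =
      q ^ (3 * (n + 1) ^ 2) * ((q ^ 2) ^ (n + 1)) ^ 2 by rw [← pow_mul, ← pow_mul, ← pow_add]; ring_nf]
    generalize (q ^ 2) ^ (n + 1) = x at *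
    field_simp

theorem omega_second_int_sum (hq0 : q ≠ 0) (hq : ‖q‖ < 1) :
    Summable (fun n : {n : ℤ // n ≠ 0} =>
      (3 * ((n : ℤ) : ℂ) - 1) * q ^ (3 * (n : ℤ) ^ 2) / (1 - q ^ (2 * (n : ℤ)))) ∧
    ∑' n : {n : ℤ // n ≠ 0},
      (3 * ((n : ℤ) : ℂ) - 1) * q ^ (3 * (n : ℤ) ^ 2) / (1 - q ^ (2 * (n : ℤ))) =
      ∑' n : ℕ, ((3 * ((n : ℂ) + 1) - 1) * q ^ (3 * (n + 1) ^ 2) / (1 - (q ^ 2) ^ (n + 1)) +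
        (3 * ((n : ℂ) + 1) + 1) * q ^ (3 * (n + 1) ^ 2 + 2 * (n + 1)) /
          (1 - (q ^ 2) ^ (n + 1))) := by
  have hQ := norm_sq_lt_one hq
  refine summable_and_tsum_int_ne_zero
    (f := fun n : ℤ => (3 * (n : ℂ) - 1) * q ^ (3 * n ^ 2) / (1 - q ^ (2 * n)))
    ((summable_linear_mul_pow_div hq hQ 3 (-1) (e := fun n => 3 * (n + 1) ^ 2)
      (fun n => by nlinarith) 1).congr fun n => by simp [sub_eq_add_neg])
    ((summable_linear_mul_pow_div hq hQ 3 1 (e := fun n => 3 * (n + 1) ^ 2 + 2 * (n + 1))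
      (fun n => by nlinarith) 1).congr fun n => by simp) (fun n => ?_) (fun n => ?_)
  · rw [three_mul_sq_exponent, zpow_natCast, zpow_mul, zpow_ofNat, zpow_natCast_add_one]
    push_cast
    rfl
  · rw [three_mul_neg_sq_exponent, zpow_natCast, zpow_mul, zpow_ofNat,
      one_sub_zpow_neg (pow_ne_zero 2 hq0)]
    have h1 := pow_ne_zero (n + 1) (pow_ne_zero 2 hq0)
    have h2 := one_sub_pow_ne_zero hQ n.succ_ne_zero
    rw [Nat.succ_eq_add_one] at h2
    rw [pow_add q _ (2 * (n + 1)), pow_mul q 2 (n + 1)]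
    push_cast
    generalize (q ^ 2) ^ (n + 1) = x at *
    field_simp
    ring

end IntegerSums

/-! ### The two identities for `q ≠ 0` -/

section Identities

variable {q : ℂ}

theorem summable_fTerm (hq : ‖q‖ < 1) : Summable (fTerm q) := by
  obtain ⟨C, hC0, hC⟩ := exists_norm_inv_qPoch_le hq (neg_self_mul_pow_ne_one hq)
  refine Summable.of_norm_bounded ((summable_geometric_of_lt_one (norm_nonneg q) hq).mul_right
    (C ^ 2)) fun n => ?_
  rw [fTerm, div_eq_mul_inv, norm_mul, ← inv_pow, norm_pow _ 2]
  have h1 := norm_pow_le_of_le hq (show n ≤ n ^ 2 by nlinarith)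
  have h2 := hC n
  gcongr

theorem summable_omegaTerm_neg (hq : ‖q‖ < 1) : Summable (omegaTerm (-q)) := by
  obtain ⟨C, hC0, hC⟩ := exists_norm_inv_qPoch_le (norm_sq_lt_one hq) (neg_mul_sq_pow_ne_one hq)
  refine Summable.of_norm_bounded ((summable_geometric_of_lt_one (norm_nonneg q) hq).mul_right
    (C ^ 2)) fun n => ?_
  rw [omegaTerm, neg_sq, div_eq_mul_inv, norm_mul, ← inv_pow, norm_pow _ 2]
  have h1 := norm_pow_le_of_le (q := -q) (by rwa [norm_neg])
    (show n ≤ 2 * n * (n + 1) by nlinarith)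
  rw [norm_neg] at h1
  have h2 := hC (n + 1)
  gcongr

/-- Termwise `x / (1 + x)^2 = x / (1 - x)^2 - 4 x^2 / (1 - x^2)^2`. This turns the Lambert sum with
plus signs into the two sums of the statement for `f`. -/
theorem tsum_div_one_add_sq (hq : ‖q‖ < 1) :
    ∑' k : ℕ, q ^ (k + 1) / (1 + q ^ (k + 1)) ^ 2 =
      ∑' k : ℕ, q ^ (k + 1) / (1 - q ^ (k + 1)) ^ 2 -
        4 * ∑' k : ℕ, q ^ (2 * (k + 1)) / (1 - q ^ (2 * (k + 1))) ^ 2 := by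
  have s1 := summable_div_one_sub_sq hq (e := fun n => n + 1) (fun n => by omega)
  have s2 := summable_div_one_sub_sq hq (e := fun n => 2 * (n + 1)) (fun n => by omega)
  rw [← tsum_mul_left, ← s1.tsum_sub (s2.mul_left 4)]
  refine tsum_congr fun k => ?_
  have h1 := one_add_pow_ne_zero hq (k + 1)
  have h2 := one_sub_pow_ne_zero hq k.succ_ne_zero
  rw [Nat.succ_eq_add_one] at h2
  rw [mul_comm 2, pow_mul]
  have h3 : 1 - (q ^ (k + 1)) ^ 2 = (1 - q ^ (k + 1)) * (1 + q ^ (k + 1)) := by ring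
  rw [h3]
  generalize q ^ (k + 1) = x at *
  field_simp
  ring

theorem f_identity (hq0 : q ≠ 0) (hq : ‖q‖ < 1) :
    qPochInf q q ^ 3 / qPochInf (-q) q ^ 2 * mockF q =
      -4 * (∑' n : ℕ, q ^ (n + 1) / (1 - q ^ (n + 1)) ^ 2)
      - 16 * (∑' n : ℕ, q ^ (2 * (n + 1)) / (1 - q ^ (2 * (n + 1))) ^ 2)
      + 1
      + 4 * (∑' n : {n : ℤ // n ≠ 0},
          q ^ ((n : ℤ) * (3 * (n : ℤ) + 1) / 2) / (1 - q ^ (n : ℤ)) ^ 2)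
      + 2 * (∑' n : {n : ℤ // n ≠ 0},
          (6 * ((n : ℤ) : ℂ) - 1) * q ^ ((n : ℤ) * (3 * (n : ℤ) + 1) / 2)
            / (1 - q ^ (n : ℤ))) := by
  have key := f_lambert_identity hq0 hq
  rw [← qPochInf_mul_mockF hq0 hq, tsum_div_one_add_sq hq] at key
  have hP := qPochInf_ne_zero hq (self_mul_pow_ne_one hq)
  have hR := qPochInf_ne_zero hq (neg_self_mul_pow_ne_one hq)
  have a1 := summable_linear_mul_pow_div hq hq 0 1 (e := fun n => (n + 1) ^ 2 + tri (n + 1))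
      (fun n => by nlinarith) 2
  have a2 := summable_linear_mul_pow_div hq hq 0 1
    (e := fun n => (n + 1) ^ 2 + tri (n + 1) + (n + 1)) (fun n => by nlinarith) 2
  have a3 := summable_linear_mul_pow_div hq hq 6 (-1) (e := fun n => (n + 1) ^ 2 + tri (n + 1))
      (fun n => by nlinarith) 1
  have a4 := summable_linear_mul_pow_div hq hq 6 1 (e := fun n => (n + 1) ^ 2 + tri (n + 1))
      (fun n => by nlinarith) 1
  -- The folded integer sums match the double-pole series term by term. The factor `-16` is what
  -- clearing the denominator `16` of the simple-pole sum leaves on that series.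
  have hS : 4 * (∑' n : {n : ℤ // n ≠ 0},
          q ^ ((n : ℤ) * (3 * (n : ℤ) + 1) / 2) / (1 - q ^ (n : ℤ)) ^ 2)
      + 2 * (∑' n : {n : ℤ // n ≠ 0},
          (6 * ((n : ℤ) : ℂ) - 1) * q ^ ((n : ℤ) * (3 * (n : ℤ) + 1) / 2)
            / (1 - q ^ (n : ℤ))) =
      -16 * ∑' n : ℕ, q ^ ((n + 1) ^ 2 + tri (n + 1)) / (2 * (1 - q ^ (n + 1))) *
        (1 / 2 - 1 / (1 - q ^ (n + 1)) - 3 * ((n + 1 : ℕ) : ℂ)) := by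
    rw [(f_first_int_sum hq0 hq).2, (f_second_int_sum hq0 hq).2, ← tsum_mul_left, ← tsum_mul_left,
      ← tsum_mul_left, ← Summable.tsum_add]
    · refine tsum_congr fun n => ?_
      have h2 := one_sub_pow_ne_zero hq n.succ_ne_zero
      rw [Nat.succ_eq_add_one] at h2
      rw [pow_add _ _ (n + 1)]
      push_cast
      generalize q ^ (n + 1) = x at *
      field_simp
      ring
    · exact ((a1.add a2).mul_left 4).congr fun n => by simp
    · exact ((a3.add a4).mul_left 2).congr fun n => by simp [sub_eq_add_neg]
  generalize (∑' n : ℕ, q ^ ((n + 1) ^ 2 + tri (n + 1)) / (2 * (1 - q ^ (n + 1))) *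
        (1 / 2 - 1 / (1 - q ^ (n + 1)) - 3 * ((n + 1 : ℕ) : ℂ))) = S at *
  rw [add_assoc _ (4 * _), hS]
  generalize (∑' n : ℕ, q ^ (n + 1) / (1 - q ^ (n + 1)) ^ 2) = A at *
  generalize (∑' n : ℕ, q ^ (2 * (n + 1)) / (1 - q ^ (2 * (n + 1))) ^ 2) = B at *
  field_simp at key ⊢
  linear_combination key / 16

theorem omega_identity (hq0 : q ≠ 0) (hq : ‖q‖ < 1) :
    q * (qPochInf (q ^ 2) (q ^ 2) ^ 3 / qPochInf (-q) (q ^ 2) ^ 2) * mockOmega (-q) =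
      (∑' n : ℕ, q ^ (2 * n + 1) / (1 + q ^ (2 * n + 1)) ^ 2)
      - 2 * (∑' n : ℕ, q ^ (2 * (n + 1)) / (1 - q ^ (2 * (n + 1))) ^ 2)
      + (∑' n : {n : ℤ // n ≠ 0},
          q ^ (3 * (n : ℤ) ^ 2) / (1 - q ^ (2 * (n : ℤ))) ^ 2)
      + (∑' n : {n : ℤ // n ≠ 0},
          (3 * ((n : ℤ) : ℂ) - 1) * q ^ (3 * (n : ℤ) ^ 2) / (1 - q ^ (2 * (n : ℤ)))) := by
  have hQ := norm_sq_lt_one hq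
  have key := omega_lambert_identity hq0 hq
  rw [← qPochInf_mul_mockOmega hq0 hq] at key
  have hP := qPochInf_ne_zero hQ (self_mul_pow_ne_one hQ)
  have hR := qPochInf_ne_zero hQ (neg_mul_sq_pow_ne_one hq)
  have a1 := summable_linear_mul_pow_div hq hQ 0 1 (e := fun n => 3 * (n + 1) ^ 2)
      (fun n => by nlinarith) 2
  have a2 := summable_linear_mul_pow_div hq hQ 0 1
    (e := fun n => 3 * (n + 1) ^ 2 + 2 * (2 * (n + 1))) (fun n => by nlinarith) 2
  have a3 := summable_linear_mul_pow_div hq hQ 3 (-1) (e := fun n => 3 * (n + 1) ^ 2)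
      (fun n => by nlinarith) 1
  have a4 := summable_linear_mul_pow_div hq hQ 3 1 (e := fun n => 3 * (n + 1) ^ 2 + 2 * (n + 1))
      (fun n => by nlinarith) 1
  have hS : (∑' n : {n : ℤ // n ≠ 0},
          q ^ (3 * (n : ℤ) ^ 2) / (1 - q ^ (2 * (n : ℤ))) ^ 2)
      + (∑' n : {n : ℤ // n ≠ 0},
          (3 * ((n : ℤ) : ℂ) - 1) * q ^ (3 * (n : ℤ) ^ 2) / (1 - q ^ (2 * (n : ℤ)))) =
      -∑' n : ℕ, q ^ (3 * (n + 1) ^ 2) * (1 + (q ^ 2) ^ (n + 1)) / (1 - (q ^ 2) ^ (n + 1)) *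
        (-(2 * (q ^ 2) ^ (n + 1) / (1 - ((q ^ 2) ^ (n + 1)) ^ 2)) - 3 * ((n + 1 : ℕ) : ℂ)) := by
    rw [(omega_first_int_sum hq0 hq).2, (omega_second_int_sum hq0 hq).2, ← tsum_neg,
      ← Summable.tsum_add]
    · refine tsum_congr fun n => ?_
      have h2 := one_sub_pow_ne_zero hQ n.succ_ne_zero
      have h3 := one_add_pow_ne_zero hQ (n + 1)
      rw [Nat.succ_eq_add_one] at h2
      rw [show q ^ (3 * (n + 1) ^ 2 + 2 * (2 * (n + 1))) =
        q ^ (3 * (n + 1) ^ 2) * ((q ^ 2) ^ (n + 1)) ^ 2 by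
          rw [← pow_mul, ← pow_mul, ← pow_add]; ring_nf,
        pow_add q _ (2 * (n + 1)), pow_mul q 2 (n + 1),
        show 1 - ((q ^ 2) ^ (n + 1)) ^ 2 = (1 - (q ^ 2) ^ (n + 1)) * (1 + (q ^ 2) ^ (n + 1)) by ring]
      push_cast
      generalize (q ^ 2) ^ (n + 1) = x at *
      field_simp
      ring
    · exact (a1.add a2).congr fun n => by simp
    · exact (a3.add a4).congr fun n => by simp [sub_eq_add_neg]
  have hB : ∑' n : ℕ, q ^ (2 * (n + 1)) / (1 - q ^ (2 * (n + 1))) ^ 2 =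
      ∑' n : ℕ, (q ^ 2) ^ (n + 1) / (1 - (q ^ 2) ^ (n + 1)) ^ 2 :=
    tsum_congr fun n => by rw [pow_mul]
  rw [hB, add_assoc _ (∑' n : {n : ℤ // n ≠ 0}, q ^ (3 * (n : ℤ) ^ 2) / _), hS]
  generalize (∑' n : ℕ, q ^ (3 * (n + 1) ^ 2) * (1 + (q ^ 2) ^ (n + 1)) / (1 - (q ^ 2) ^ (n + 1)) *
        (-(2 * (q ^ 2) ^ (n + 1) / (1 - ((q ^ 2) ^ (n + 1)) ^ 2)) - 3 * ((n + 1 : ℕ) : ℂ))) = S at *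
  generalize (∑' n : ℕ, (q ^ 2) ^ (n + 1) / (1 - (q ^ 2) ^ (n + 1)) ^ 2) = A at *
  generalize (∑' n : ℕ, q ^ (2 * n + 1) / (1 + q ^ (2 * n + 1)) ^ 2) = B at *
  field_simp at key ⊢
  linear_combination key

end Identities

/-! ### The degenerate case `q = 0` -/

section Zero

theorem qPochInf_zero_right_zero : qPochInf 0 0 = 1 := by simp [qPochInf]

theorem mockF_zero : mockF 0 = 1 := by
  rw [mockF, tsum_eq_single 0 (fun n hn => by simp [fTerm, hn])]
  simp [fTerm, qPoch]

theorem pentagonal_ne_zero {n : ℤ} (hn : n ≠ 0) : n * (3 * n + 1) / 2 ≠ 0 := by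
  intro h
  have h1 : 2 ≤ n * (3 * n + 1) := by
    rcases lt_or_gt_of_ne hn with h | h <;> nlinarith
  have h2 := Int.ediv_le_ediv two_pos h1
  omega

end Zero

end MockTheta

/-! ### Assembly of the theorem -/

theorem mainTheorem7 (q : ℂ) (hq : ‖q‖ < 1) :
    -- all the series that occur converge absolutely
    (Summable (MockTheta.fTerm q) ∧
      Summable (MockTheta.omegaTerm (-q)) ∧
      Summable (fun n : ℕ+ => q ^ (n : ℕ) / (1 - q ^ (n : ℕ)) ^ 2) ∧
      Summable (fun n : ℕ+ => q ^ (2 * (n : ℕ)) / (1 - q ^ (2 * (n : ℕ))) ^ 2) ∧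
      Summable (fun n : ℕ+ => q ^ (2 * (n : ℕ) - 1) / (1 + q ^ (2 * (n : ℕ) - 1)) ^ 2) ∧
      Summable (fun n : {n : ℤ // n ≠ 0} =>
        q ^ ((n : ℤ) * (3 * (n : ℤ) + 1) / 2) / (1 - q ^ (n : ℤ)) ^ 2) ∧
      Summable (fun n : {n : ℤ // n ≠ 0} =>
        (6 * ((n : ℤ) : ℂ) - 1) * q ^ ((n : ℤ) * (3 * (n : ℤ) + 1) / 2)
          / (1 - q ^ (n : ℤ))) ∧
      Summable (fun n : {n : ℤ // n ≠ 0} =>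
        q ^ (3 * (n : ℤ) ^ 2) / (1 - q ^ (2 * (n : ℤ))) ^ 2) ∧
      Summable (fun n : {n : ℤ // n ≠ 0} =>
        (3 * ((n : ℤ) : ℂ) - 1) * q ^ (3 * (n : ℤ) ^ 2) / (1 - q ^ (2 * (n : ℤ))))) ∧
    -- the identity for `f(q)`
    MockTheta.qPochInf q q ^ 3 / MockTheta.qPochInf (-q) q ^ 2 * MockTheta.mockF q =
      -4 * (∑' n : ℕ+, q ^ (n : ℕ) / (1 - q ^ (n : ℕ)) ^ 2)
      - 16 * (∑' n : ℕ+, q ^ (2 * (n : ℕ)) / (1 - q ^ (2 * (n : ℕ))) ^ 2)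
      + 1
      + 4 * (∑' n : {n : ℤ // n ≠ 0},
          q ^ ((n : ℤ) * (3 * (n : ℤ) + 1) / 2) / (1 - q ^ (n : ℤ)) ^ 2)
      + 2 * (∑' n : {n : ℤ // n ≠ 0},
          (6 * ((n : ℤ) : ℂ) - 1) * q ^ ((n : ℤ) * (3 * (n : ℤ) + 1) / 2)
            / (1 - q ^ (n : ℤ))) ∧
    -- the identity for `ω(-q)`
    q * (MockTheta.qPochInf (q ^ 2) (q ^ 2) ^ 3 / MockTheta.qPochInf (-q) (q ^ 2) ^ 2)
        * MockTheta.mockOmega (-q) =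
      (∑' n : ℕ+, q ^ (2 * (n : ℕ) - 1) / (1 + q ^ (2 * (n : ℕ) - 1)) ^ 2)
      - 2 * (∑' n : ℕ+, q ^ (2 * (n : ℕ)) / (1 - q ^ (2 * (n : ℕ))) ^ 2)
      + (∑' n : {n : ℤ // n ≠ 0},
          q ^ (3 * (n : ℤ) ^ 2) / (1 - q ^ (2 * (n : ℤ))) ^ 2)
      + (∑' n : {n : ℤ // n ≠ 0},
          (3 * ((n : ℤ) : ℂ) - 1) * q ^ (3 * (n : ℤ) ^ 2) / (1 - q ^ (2 * (n : ℤ)))) := by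
  have hA := tsum_pnat_eq_tsum_succ (f := fun n => q ^ n / (1 - q ^ n) ^ 2)
  have hB := tsum_pnat_eq_tsum_succ (f := fun n => q ^ (2 * n) / (1 - q ^ (2 * n)) ^ 2)
  have hC := tsum_pnat_eq_tsum_succ (f := fun n => q ^ (2 * n - 1) / (1 + q ^ (2 * n - 1)) ^ 2)
  simp only [show ∀ n, 2 * (n + 1) - 1 = 2 * n + 1 by omega] at hC
  have sA := summable_pnat_iff_summable_succ (f := fun n => q ^ n / (1 - q ^ n) ^ 2) |>.2
    (MockTheta.summable_div_one_sub_sq hq fun n => n.lt_succ_self)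
  have sB := summable_pnat_iff_summable_succ (f := fun n => q ^ (2 * n) / (1 - q ^ (2 * n)) ^ 2) |>.2
    (MockTheta.summable_div_one_sub_sq hq (e := fun n => 2 * (n + 1)) fun n => by omega)
  have sC := summable_pnat_iff_summable_succ
    (f := fun n => q ^ (2 * n - 1) / (1 + q ^ (2 * n - 1)) ^ 2) |>.2
    (MockTheta.summable_div_one_add_sq hq (e := fun n => 2 * (n + 1) - 1) fun n => by omega)
  rcases eq_or_ne q 0 with rfl | hq0
  -- At `q = 0` the numerators vanish because their exponents are nonzero, so every term of the
  -- integer sums is 0, in agreement with the limit convention for `n < 0`.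
  · have e1 : ∀ n : {n : ℤ // n ≠ 0}, (0 : ℂ) ^ ((n : ℤ) * (3 * (n : ℤ) + 1) / 2) = 0 := fun n =>
      zero_zpow _ (MockTheta.pentagonal_ne_zero n.2)
    have e2 : ∀ n : {n : ℤ // n ≠ 0}, (0 : ℂ) ^ (3 * (n : ℤ) ^ 2) = 0 := fun n =>
      zero_zpow _ (mul_ne_zero three_ne_zero (pow_ne_zero 2 n.2))
    refine ⟨⟨MockTheta.summable_fTerm hq, MockTheta.summable_omegaTerm_neg hq, sA, sB, sC,
      ?_, ?_, ?_, ?_⟩, ?_, ?_⟩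
    · simpa only [e1, zero_div] using summable_zero
    · simpa only [e1, mul_zero, zero_div] using summable_zero
    · simpa only [e2, zero_div] using summable_zero
    · simpa only [e2, mul_zero, zero_div] using summable_zero
    · rw [hA, hB]
      simp [e1, MockTheta.qPochInf_zero_right_zero, MockTheta.mockF_zero]
    · rw [hB, hC]
      simp [e2]
  · refine ⟨⟨MockTheta.summable_fTerm hq, MockTheta.summable_omegaTerm_neg hq, sA, sB, sC,
      (MockTheta.f_first_int_sum hq0 hq).1, (MockTheta.f_second_int_sum hq0 hq).1,
      (MockTheta.omega_first_int_sum hq0 hq).1, (MockTheta.omega_second_int_sum hq0 hq).1⟩, ?_, ?_⟩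
    · rw [hA, hB]
      exact MockTheta.f_identity hq0 hq
    · rw [hB, hC]
      exact MockTheta.omega_identity hq0 hq
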